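/- A Leja sequence for the closed unit disk $D=\{|z|\le 1\}$ is a sequence $(e_k)_{k\ge 0}$ in $D$ with $e_0=1$ such that, for every $j\ge 1$, $$\prod_{m=0}^{j-1}|e_j-e_m|=\max_{z\in D}\prod_{m=0}^{j-1}|z-e_m| .$$ An $\Re$-Leja sequence is a sequence obtained from the sequence of real parts $(\Re e_k)_{k\ge 0}$ of some Leja sequence by eliminating repeated values (keeping first occurrences, in order). Let $N\ge 1$ and let $X^{(j)}=(x^{(j)}_k)_{k\ge 0}$, $j=1,\dots,N$, be $\Re$-Leja sequences, not necessarily distinct. For $k\ge 0$ put $$\mathbf P_k=\Big\{(x^{(1)}_{\alpha_1},\dots,x^{(N)}_{\alpha_N}) : \alpha\in\mathbb N^N,\ \sum_{j=1}^N\alpha_j\le k\Big\}.$$ Then $\mathbf P_k\subset[-1,1]^N$, and for every function $f:\mathbf P_k\to\mathbb R$ there is exactly one real polynomial in $N$ variables of total degree at most $k$ that agrees with $f$ on $\mathbf P_k$. Let $\Delta(\mathbf P_k)$ be the Lebesgue constant, that is, the operator norm, on $C([-1,1]^N)$ with the maximum norm, of the operator that sends $f$ to the polynomial of total degree at most $k$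 that agrees with $f$ on $\mathbf P_k$. Then $\Delta(\mathbf P_k)$ grows at most like a polynomial in $k$: there is $m\in\mathbb N$ with $\Delta(\mathbf P_k)=O(k^m)$ as $k\to\infty$. More precisely, $$\Delta(\mathbf P_k)=O\Big(k^{(N^2+11N-6)/2}\,\log^N k\Big),\qquad k\to\infty .$$ -/

import Mathlib

open Filter Asymptotics

/-- `E` is a Leja sequence for the closed unit disk: it starts at `1`, and each later entry is a
point of the disk that maximizes the product of the distances to the previous entries. -/
def IsLejaSequence (E : ℕ → ℂ) : Prop :=
  E 0 = 1 ∧ ∀ j : ℕ, 1 ≤ j → E j ∈ Metric.closedBall (0 : ℂ) 1 ∧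
    ∀ z ∈ Metric.closedBall (0 : ℂ) 1,
      ∏ m ∈ Finset.range j, ‖z - E m‖ ≤ ∏ m ∈ Finset.range j, ‖E j - E m‖

/-- `X` is obtained by eliminating repeated points in the sequence of real parts of a Leja sequence:
`φ` enumerates in increasing order the indices at which a real part occurs for the first time. -/
def IsReLejaSequence (X : ℕ → ℝ) : Prop :=
  ∃ E : ℕ → ℂ, IsLejaSequence E ∧ ∃ φ : ℕ → ℕ, StrictMono φ ∧
    Set.range φ = {k : ℕ | ∀ j < k, (E j).re ≠ (E k).re} ∧ ∀ k, X k = (E (φ k)).re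

/-- The set `P_k` underlying the intertwining of the sequences `X 0, …, X (N - 1)`: all points
`(X 0 (α 0), …, X (N - 1) (α (N - 1)))` whose index sum is at most `k`. -/
def intertwining {N : ℕ} (X : Fin N → ℕ → ℝ) (k : ℕ) : Set (Fin N → ℝ) :=
  {x | ∃ α : Fin N → ℕ, ∑ j, α j ≤ k ∧ x = fun j => X j (α j)}

/-- `A` is a valid set of nodes for interpolation by `N`-variable polynomials of total degree at
most `d`: all data on `A` are matched by exactly one such polynomial. -/
def IsUnisolvent {N : ℕ} (d : ℕ) (A : Set (Fin N → ℝ)) : Prop :=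
  ∀ f : A → ℝ, ∃! p : MvPolynomial (Fin N) ℝ,
    p.totalDegree ≤ d ∧ ∀ a : A, MvPolynomial.eval (a : Fin N → ℝ) p = f a

/-- The restriction to `A` of polynomials of total degree at most `d`. -/
noncomputable def evalOn {N : ℕ} (d : ℕ) (A : Set (Fin N → ℝ)) :
    MvPolynomial.restrictTotalDegree (Fin N) ℝ d →ₗ[ℝ] (A → ℝ) where
  toFun p a := MvPolynomial.eval (a : Fin N → ℝ) p.1
  map_add' p q := by ext a; simp
  map_smul' c p := by ext a; simp

theorem IsUnisolvent.bijective_evalOn {N d : ℕ} {A : Set (Fin N → ℝ)} (h : IsUnisolvent d A) :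
    Function.Bijective (evalOn d A) := by
  constructor
  · intro p q hpq
    apply Subtype.ext
    refine (h (evalOn d A q)).unique ⟨?_, fun a => congrFun hpq a⟩ ⟨?_, fun a => rfl⟩
    · exact (MvPolynomial.mem_restrictTotalDegree _ _ _).1 p.2
    · exact (MvPolynomial.mem_restrictTotalDegree _ _ _).1 q.2
  · intro f
    obtain ⟨p, ⟨hp, hpf⟩, -⟩ := h f
    exact ⟨⟨p, (MvPolynomial.mem_restrictTotalDegree _ _ _).2 hp⟩, funext hpf⟩

/-- The unique polynomial of total degree at most `d` with prescribed values on a valid set `A`,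
as a linear function of these values. -/
noncomputable def interpolant {N d : ℕ} {A : Set (Fin N → ℝ)} (h : IsUnisolvent d A) :
    (A → ℝ) →ₗ[ℝ] MvPolynomial (Fin N) ℝ :=
  (MvPolynomial.restrictTotalDegree (Fin N) ℝ d).subtype ∘ₗ
    ((LinearEquiv.ofBijective (evalOn d A) h.bijective_evalOn).symm : (A → ℝ) →ₗ[ℝ] _)

theorem interpolant_spec {N d : ℕ} {A : Set (Fin N → ℝ)} (h : IsUnisolvent d A) (f : A → ℝ) :
    (interpolant h f).totalDegree ≤ d ∧
      ∀ a : A, MvPolynomial.eval (a : Fin N → ℝ) (interpolant h f) = f a := by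
  refine ⟨(MvPolynomial.mem_restrictTotalDegree _ _ _).1
    ((LinearEquiv.ofBijective (evalOn d A) h.bijective_evalOn).symm f).2, fun a => ?_⟩
  exact congrFun ((LinearEquiv.ofBijective (evalOn d A) h.bijective_evalOn).apply_symm_apply f) a

theorem IsUnisolvent.finite {N d : ℕ} {A : Set (Fin N → ℝ)} (h : IsUnisolvent d A) :
    FiniteDimensional ℝ (A → ℝ) := by
  have : FiniteDimensional ℝ (MvPolynomial.restrictTotalDegree (Fin N) ℝ d) := by
    infer_instance
  exact Module.Finite.equiv (LinearEquiv.ofBijective (evalOn d A) h.bijective_evalOn)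

/-- The restriction to `K` of a polynomial, as a continuous function on `K`. -/
noncomputable def polyOn {N : ℕ} (K : Set (Fin N → ℝ)) : MvPolynomial (Fin N) ℝ →ₗ[ℝ] C(K, ℝ) where
  toFun p := ⟨fun x => MvPolynomial.eval (x : Fin N → ℝ) p,
    (MvPolynomial.continuous_eval p).comp continuous_subtype_val⟩
  map_add' p q := by ext x; simp
  map_smul' c p := by ext x; simp

/-- The values of a continuous function on `K` at the points of a subset `A`. -/
noncomputable def valuesOn {N : ℕ} {A K : Set (Fin N → ℝ)} (hAK : A ⊆ K) :
    C(K, ℝ) →L[ℝ] (A → ℝ) where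
  toFun f a := f ⟨a, hAK a.2⟩
  map_add' f g := by ext a; simp
  map_smul' c f := by ext a; simp
  cont := continuous_pi fun a => continuous_eval_const (F := C(K, ℝ)) (⟨a, hAK a.2⟩ : K)

/-- The Lagrange interpolation operator `f ↦ L[A; f]` on `C(K)`, which sends `f` to the polynomial
of total degree at most `d` that agrees with `f` on `A`. -/
noncomputable def lagrangeOperator {N d : ℕ} {A K : Set (Fin N → ℝ)} (hAK : A ⊆ K)
    (h : IsUnisolvent d A) : C(K, ℝ) →L[ℝ] C(K, ℝ) where
  toLinearMap := polyOn K ∘ₗ interpolant h ∘ₗ (valuesOn hAK : C(K, ℝ) →ₗ[ℝ] (A → ℝ))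
  cont := by
    have := h.finite
    exact (LinearMap.continuous_of_finiteDimensional (polyOn K ∘ₗ interpolant h)).comp
      (valuesOn hAK).continuous

/-- The Lebesgue constant `Δ(A) = Δ(A, K)`: the norm of the Lagrange interpolation operator on
`C(K)`, where `C(K)` carries the maximum norm. -/
noncomputable def lebesgueConstant {N d : ℕ} {A K : Set (Fin N → ℝ)} [CompactSpace K] (hAK : A ⊆ K)
    (h : IsUnisolvent d A) : ℝ :=
  ‖lagrangeOperator hAK h‖

/-! The first `2 ^ n` points of a Leja sequence are the roots of unity of order `2 ^ n`, and the
next `2 ^ n` points are a rotated Leja section (`lejaSectionsAreRoots`, `isLejaSection_lejaShift`).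
Hence products of distances to the first `r` points factor along the binary expansion of `r`, which
gives explicit two-sided bounds (`prod_norm_bounds`).

On the unit circle `2 * |Re z - Re e| = ‖z - e‖ * ‖conj z - e‖`, so node polynomials of the real
parts become products of complex ones. The first occurrences of real parts are the indices `0`, `1`
and the first half of each dyadic block, the second half consisting of conjugates of the first.
Comparing numerator and denominator bounds each univariate Lagrange polynomial on `k + 1` nodes by
`8 * (k + 1) ^ 2` on `[-1, 1]` (`prod_erase_le`).

In `N` variables, the Lagrange polynomials of the intertwining are sums over `|α| ≤ k` of products
of differences of univariate Lagrange polynomials. Summing absolute values gives `(16 * (k + 1) ^ 4)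
^ N`, and `4 * N` is at most the claimed exponent when `N ≥ 2`. For `N = 1` the univariate bound
gives the exponent `3` directly. The logarithms are not needed. -/

open scoped ComplexConjugate

/-! ### Dyadic structure of Leja sections -/

/-- The first `n` terms of `E` form the beginning of a Leja sequence for the unit disk. -/
def IsLejaSection (n : ℕ) (E : ℕ → ℂ) : Prop :=
  E 0 = 1 ∧ ∀ j : ℕ, 1 ≤ j → j < n → ‖E j‖ ≤ 1 ∧
    ∀ z : ℂ, ‖z‖ ≤ 1 →
      ∏ m ∈ Finset.range j, ‖z - E m‖ ≤ ∏ m ∈ Finset.range j, ‖E j - E m‖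

theorem IsLejaSequence.isLejaSection {E : ℕ → ℂ} (h : IsLejaSequence E) (n : ℕ) :
    IsLejaSection n E := by
  refine ⟨h.1, fun j hj _ => ?_⟩
  simpa [Metric.mem_closedBall, dist_zero_right] using h.2 j hj

theorem IsLejaSection.mono {m n : ℕ} {E : ℕ → ℂ} (h : IsLejaSection n E) (hmn : m ≤ n) :
    IsLejaSection m E :=
  ⟨h.1, fun j hj hjm => h.2 j hj (hjm.trans_le hmn)⟩

theorem IsLejaSection.congr {n : ℕ} {E F : ℕ → ℂ} (h : IsLejaSection n E) (hn : 1 ≤ n)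
    (hEF : ∀ i < n, F i = E i) : IsLejaSection n F := by
  refine ⟨by rw [hEF 0 hn, h.1], fun j hj hjn => ?_⟩
  have key : ∀ z : ℂ, ∏ m ∈ Finset.range j, ‖z - F m‖ = ∏ m ∈ Finset.range j, ‖z - E m‖ :=
    fun z => Finset.prod_congr rfl fun m hm => by
      rw [hEF m ((Finset.mem_range.1 hm).trans hjn)]
  simpa [key, hEF j hjn] using h.2 j hj hjn

/-- The disk is infinite, so the maximal product is positive and no factor vanishes at the
maximizer. -/
theorem IsLejaSection.ne {n : ℕ} {E : ℕ → ℂ} (h : IsLejaSection n E) {i j : ℕ} (hij : i < j)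
    (hj : j < n) : E j ≠ E i := by
  have hinf : (Metric.closedBall (0 : ℂ) 1).Infinite :=
    infinite_of_mem_nhds 0 (Metric.closedBall_mem_nhds 0 one_pos)
  obtain ⟨z, hz, hzE⟩ := hinf.exists_notMem_finset ((Finset.range j).image E)
  have hpos : 0 < ∏ m ∈ Finset.range j, ‖z - E m‖ := by
    refine Finset.prod_pos fun m hm => norm_pos_iff.2 (sub_ne_zero.2 ?_)
    rintro rfl
    exact hzE (Finset.mem_image_of_mem _ hm)
  have h1 := hpos.trans_le ((h.2 j (by omega) hj).2 z (by simpa using hz))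
  intro h0
  rw [Finset.prod_eq_zero (Finset.mem_range.2 hij) (by simp [h0])] at h1
  exact lt_irrefl _ h1

/-- Maximizers exist by compactness. Extending a section to length `2 ^ n` shows that some maximizer
for it is a root of unity. -/
theorem IsLejaSection.exists_extension {n : ℕ} {E : ℕ → ℂ} (h : IsLejaSection n E) (hn : 1 ≤ n)
    (k : ℕ) : ∃ F : ℕ → ℂ, IsLejaSection (n + k) F ∧ ∀ i < n, F i = E i := by
  induction k with
  | zero => exact ⟨E, h, fun _ _ => rfl⟩
  | succ k ih =>
    obtain ⟨F, hF, hFE⟩ := ih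
    obtain ⟨w, hw, hmax⟩ := (isCompact_closedBall (0 : ℂ) 1).exists_isMaxOn
      (Metric.nonempty_closedBall.2 zero_le_one)
      (f := fun z : ℂ => ∏ m ∈ Finset.range (n + k), ‖z - F m‖) (by fun_prop)
    have hupd : ∀ i < n + k, Function.update F (n + k) w i = F i :=
      fun i hi => Function.update_of_ne hi.ne _ _
    refine ⟨Function.update F (n + k) w, ?_, fun i hi => ?_⟩
    · have hsec := hF.congr (by omega) hupd
      refine ⟨hsec.1, fun j hj hjn => ?_⟩
      rcases (show j < n + k ∨ j = n + k by omega) with hlt | rfl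
      · exact hsec.2 j hj hlt
      · have key : ∀ z : ℂ, ∏ m ∈ Finset.range (n + k), ‖z - Function.update F (n + k) w m‖
            = ∏ m ∈ Finset.range (n + k), ‖z - F m‖ :=
          fun z => Finset.prod_congr rfl fun m hm => by rw [hupd m (Finset.mem_range.1 hm)]
        simp only [key, Function.update_self]
        refine ⟨by simpa using hw, fun z hz => ?_⟩
        exact hmax (show z ∈ Metric.closedBall (0 : ℂ) 1 by simpa using hz)
    · rw [hupd i (by omega), hFE i hi]

theorem norm_eq_one_of_pow_eq_neg_one {z : ℂ} {n : ℕ} (hn : n ≠ 0) (h : z ^ n = -1) : ‖z‖ = 1 := by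
  have : ‖z‖ ^ n = 1 := by rw [← norm_pow, h, norm_neg, norm_one]
  exact (pow_eq_one_iff_of_nonneg (norm_nonneg _) hn).1 this

theorem Complex.eq_neg_one_of_two_le_norm_sub_one {w : ℂ} (hw : ‖w‖ ≤ 1) (h : 2 ≤ ‖w - 1‖) :
    w = -1 := by
  have h1 : Complex.normSq w ≤ 1 := by
    rw [Complex.normSq_eq_norm_sq]; nlinarith [norm_nonneg w]
  have h2 : 4 ≤ Complex.normSq (w - 1) := by
    rw [Complex.normSq_eq_norm_sq]; nlinarith
  simp only [Complex.normSq_apply, Complex.sub_re, Complex.sub_im, Complex.one_re,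
    Complex.one_im] at h1 h2
  apply Complex.ext <;> simp <;> nlinarith [sq_nonneg (w.re + 1), sq_nonneg w.im]

theorem exists_pow_eq_neg_one (n : ℕ) (hn : n ≠ 0) : ∃ z : ℂ, z ^ n = -1 :=
  IsAlgClosed.exists_pow_nat_eq _ (Nat.pos_of_ne_zero hn)

theorem pow_eq_neg_one_of_isMax {n : ℕ} {w : ℂ} (hn : n ≠ 0) (hw : ‖w‖ ≤ 1)
    (h : ∀ z : ℂ, ‖z‖ ≤ 1 → ‖z ^ n - 1‖ ≤ ‖w ^ n - 1‖) : w ^ n = -1 := by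
  obtain ⟨z, hz⟩ := exists_pow_eq_neg_one n hn
  refine Complex.eq_neg_one_of_two_le_norm_sub_one ?_ ?_
  · rw [norm_pow]; exact pow_le_one₀ (norm_nonneg _) hw
  · have := h z (norm_eq_one_of_pow_eq_neg_one hn hz).le
    rw [hz] at this
    norm_num at this
    simpa using this

/-- The part of a Leja section that follows its first `2 ^ n` points, rotated so as to start
at `1`. -/
noncomputable def lejaShift (n : ℕ) (E : ℕ → ℂ) (j : ℕ) : ℂ :=
  E (2 ^ n + j) / E (2 ^ n)

/-- Every Leja section of length `2 ^ n` consists of the roots of unity of order `2 ^ n`. -/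
def LejaSectionsAreRoots (n : ℕ) : Prop :=
  ∀ E : ℕ → ℂ, IsLejaSection (2 ^ n) E →
    ∀ z : ℂ, ∏ j ∈ Finset.range (2 ^ n), (z - E j) = z ^ 2 ^ n - 1

theorem LejaSectionsAreRoots.pow_eq_neg_one {n : ℕ} (H : LejaSectionsAreRoots n) {E : ℕ → ℂ}
    (h : IsLejaSection (2 ^ n + 1) E) : E (2 ^ n) ^ 2 ^ n = -1 := by
  have hs := h.2 (2 ^ n) Nat.one_le_two_pow (by omega)
  refine pow_eq_neg_one_of_isMax (by positivity) hs.1 fun z hz => ?_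
  have := hs.2 z hz
  simpa only [← norm_prod, H E (h.mono (by omega))] using this

/-- With `ρ = E (2 ^ n)`, the product to be maximized at `ρ * z` is `‖z ^ 2 ^ n + 1‖` times the
product for the shift. Some maximizer of the second factor is a root of unity of order `2 ^ n`,
where the first factor also takes its maximal value `2`. So the next Leja point must maximize the
second factor too. -/
theorem LejaSectionsAreRoots.isLejaSection_lejaShift {n : ℕ} (H : LejaSectionsAreRoots n)
    {E : ℕ → ℂ} {r : ℕ} (hr : 1 ≤ r) (hrn : r ≤ 2 ^ n) (h : IsLejaSection (2 ^ n + r) E) :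
    IsLejaSection r (lejaShift n E) := by
  have hρ := H.pow_eq_neg_one (h.mono (by omega))
  have hρ1 : ‖E (2 ^ n)‖ = 1 := norm_eq_one_of_pow_eq_neg_one (by positivity) hρ
  have hρ0 : E (2 ^ n) ≠ 0 := by
    intro h0; simp [h0] at hρ1
  have hE : ∀ j, E (2 ^ n + j) = E (2 ^ n) * lejaShift n E j := fun j => by
    rw [lejaShift]; field_simp
  have h2n : 1 ≤ 2 ^ n := Nat.one_le_two_pow
  induction r with
  | zero => omega
  | succ r ih =>
    rcases Nat.eq_zero_or_pos r with rfl | hr0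
    · exact ⟨by simp [lejaShift, hρ0], fun j hj hj' => by omega⟩
    have ih' := ih hr0 (by omega) (h.mono (by omega))
    -- `F r` is a maximizer for the shift which, by `H`, is a root of unity; it is the competitor
    -- used in `h3`.
    obtain ⟨F, hF, hFE⟩ := ih'.exists_extension hr0 (2 ^ n - r)
    rw [show r + (2 ^ n - r) = 2 ^ n by omega] at hF
    have hQ : ∀ z : ℂ, ∏ m ∈ Finset.range r, ‖z - F m‖
        = ∏ m ∈ Finset.range r, ‖z - lejaShift n E m‖ := fun z =>
      Finset.prod_congr rfl fun m hm => by rw [hFE m (Finset.mem_range.1 hm)]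
    have hFr := hF.2 r hr0 (by omega)
    simp only [hQ] at hFr
    have hFroot : F r ^ 2 ^ n = 1 := by
      have := H F hF (F r)
      rw [Finset.prod_eq_zero (Finset.mem_range.2 (show r < 2 ^ n by omega)) (sub_self _)] at this
      exact (sub_eq_zero.1 this.symm)
    have hprod : ∀ z : ℂ, ∏ m ∈ Finset.range (2 ^ n + r), ‖E (2 ^ n) * z - E m‖
        = ‖z ^ 2 ^ n + 1‖ * ∏ m ∈ Finset.range r, ‖z - lejaShift n E m‖ := fun z => by
      rw [Finset.prod_range_add, ← norm_prod, H E (h.mono (by omega)), mul_pow, hρ]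
      congr 1
      · rw [← norm_neg]; congr 1; ring
      · refine Finset.prod_congr rfl fun m _ => ?_
        rw [hE m, ← mul_sub, norm_mul, hρ1, one_mul]
    have hs := h.2 (2 ^ n + r) (by omega) (by omega)
    have hn1 : ‖lejaShift n E r‖ ≤ 1 := by
      rw [lejaShift, norm_div, hρ1, div_one]; exact hs.1
    refine ⟨ih'.1, fun j hj hjr => ?_⟩
    rcases (show j < r ∨ j = r by omega) with hlt | rfl
    · exact ih'.2 j hj hlt
    refine ⟨hn1, fun z hz => (hFr.2 z hz).trans ?_⟩
    have h3 := hs.2 (E (2 ^ n) * F j) (by rw [norm_mul, hρ1, one_mul]; exact hFr.1)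
    rw [hE j, hprod, hprod, hFroot] at h3
    have h4 : ‖lejaShift n E j ^ 2 ^ n + 1‖ ≤ 2 := by
      refine (norm_add_le _ _).trans ?_
      rw [norm_pow, norm_one]
      linarith [pow_le_one₀ (n := 2 ^ n) (norm_nonneg _) hn1]
    have h5 : ‖(1 : ℂ) + 1‖ = 2 := by norm_num
    rw [h5] at h3
    have h6 : 0 ≤ ∏ m ∈ Finset.range j, ‖lejaShift n E j - lejaShift n E m‖ :=
      Finset.prod_nonneg fun _ _ => norm_nonneg _
    nlinarith

/-- The two halves contribute `z ^ 2 ^ n - 1` and, by the rotation with `ρ ^ 2 ^ n = -1`, `z ^ 2 ^ n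
+ 1`. -/
theorem lejaSectionsAreRoots (n : ℕ) : LejaSectionsAreRoots n := by
  induction n with
  | zero => intro E h z; simp [h.1]
  | succ n H =>
    intro E h z
    rw [pow_succ, mul_two] at h
    have h2n : 1 ≤ 2 ^ n := Nat.one_le_two_pow
    have hρ := H.pow_eq_neg_one (h.mono (by omega))
    have hρ0 : E (2 ^ n) ≠ 0 := by
      intro h0
      rw [h0, zero_pow (by positivity)] at hρ
      norm_num at hρ
    have hE : ∀ j, E (2 ^ n + j) = E (2 ^ n) * lejaShift n E j := fun j => by
      rw [lejaShift]; field_simp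
    have hs := H _ (H.isLejaSection_lejaShift h2n le_rfl h) (z / E (2 ^ n))
    have : ∏ j ∈ Finset.range (2 ^ n), (z - E (2 ^ n + j)) = z ^ 2 ^ n + 1 := by
      calc _ = ∏ j ∈ Finset.range (2 ^ n), E (2 ^ n) * (z / E (2 ^ n) - lejaShift n E j) := by
            refine Finset.prod_congr rfl fun j _ => ?_
            rw [hE j]; field_simp
        _ = z ^ 2 ^ n + 1 := by
            rw [Finset.prod_mul_distrib, hs, Finset.prod_const, Finset.card_range, div_pow, hρ]
            ring
    rw [pow_succ 2 n, mul_two, Finset.prod_range_add, H E (h.mono (by omega)), this, pow_add]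
    ring

section Structure

variable {n r : ℕ} {E : ℕ → ℂ}

theorem IsLejaSection.prod_sub (h : IsLejaSection (2 ^ n) E) (z : ℂ) :
    ∏ j ∈ Finset.range (2 ^ n), (z - E j) = z ^ 2 ^ n - 1 :=
  lejaSectionsAreRoots n E h z

theorem IsLejaSection.pow_two_pow_eq_one (h : IsLejaSection (2 ^ n) E) {j : ℕ} (hj : j < 2 ^ n) :
    E j ^ 2 ^ n = 1 := by
  have := h.prod_sub (E j)
  rw [Finset.prod_eq_zero (Finset.mem_range.2 hj) (sub_self _)] at this
  exact (sub_eq_zero.1 this.symm)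

theorem IsLejaSection.exists_eq_of_pow_eq_one (h : IsLejaSection (2 ^ n) E) {z : ℂ}
    (hz : z ^ 2 ^ n = 1) : ∃ j < 2 ^ n, E j = z := by
  have := h.prod_sub z
  rw [hz, sub_self, Finset.prod_eq_zero_iff] at this
  obtain ⟨j, hj, hj0⟩ := this
  exact ⟨j, Finset.mem_range.1 hj, (sub_eq_zero.1 hj0).symm⟩

theorem IsLejaSection.pow_two_pow_eq_neg_one (h : IsLejaSection (2 ^ n + 1) E) :
    E (2 ^ n) ^ 2 ^ n = -1 :=
  (lejaSectionsAreRoots n).pow_eq_neg_one h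

theorem IsLejaSection.norm_two_pow (h : IsLejaSection (2 ^ n + 1) E) : ‖E (2 ^ n)‖ = 1 :=
  norm_eq_one_of_pow_eq_neg_one (by positivity) h.pow_two_pow_eq_neg_one

theorem IsLejaSection.add_eq_mul_lejaShift (h : IsLejaSection (2 ^ n + 1) E) (j : ℕ) :
    E (2 ^ n + j) = E (2 ^ n) * lejaShift n E j := by
  have : E (2 ^ n) ≠ 0 := by
    intro h0; have := h.norm_two_pow; simp [h0] at this
  rw [lejaShift]; field_simp

theorem IsLejaSection.lejaShift (h : IsLejaSection (2 ^ n + r) E) (hr : 1 ≤ r) (hrn : r ≤ 2 ^ n) :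
    IsLejaSection r (lejaShift n E) :=
  (lejaSectionsAreRoots n).isLejaSection_lejaShift hr hrn h

theorem IsLejaSection.norm_eq_one (h : IsLejaSection (2 ^ n) E) {j : ℕ} (hj : j < 2 ^ n) :
    ‖E j‖ = 1 := by
  have h1 : ‖E j‖ ^ 2 ^ n = 1 := by rw [← norm_pow, h.pow_two_pow_eq_one hj, norm_one]
  exact (pow_eq_one_iff_of_nonneg (norm_nonneg _) (by positivity)).1 h1

end Structure

/-! ### Splitting products and elementary bounds for powers -/

theorem Finset.prod_erase_eq_prod_ite {ι M : Type*} [DecidableEq ι] [CommMonoid M] (s : Finset ι)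
    (f : ι → M) (j : ι) :
    ∏ i ∈ s.erase j, f i = ∏ i ∈ s, if i = j then 1 else f i := by
  rw [Finset.prod_ite, Finset.prod_const_one, one_mul]
  refine Finset.prod_congr ?_ fun _ _ => rfl
  ext i; simp [and_comm]

theorem Finset.prod_range_add_erase_of_lt {M : Type*} [CommMonoid M] (f : ℕ → M) {a b j : ℕ}
    (hj : j < a) :
    ∏ i ∈ (Finset.range (a + b)).erase j, f i
      = (∏ i ∈ (Finset.range a).erase j, f i) * ∏ i ∈ Finset.range b, f (a + i) := by
  rw [prod_erase_eq_prod_ite, prod_erase_eq_prod_ite, Finset.prod_range_add]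
  congr 1
  exact Finset.prod_congr rfl fun i _ => if_neg (by omega)

theorem Finset.prod_range_add_erase_add {M : Type*} [CommMonoid M] (f : ℕ → M) {a b j : ℕ} :
    ∏ i ∈ (Finset.range (a + b)).erase (a + j), f i
      = (∏ i ∈ Finset.range a, f i) * ∏ i ∈ (Finset.range b).erase j, f (a + i) := by
  rw [prod_erase_eq_prod_ite, prod_erase_eq_prod_ite, Finset.prod_range_add]
  congr 1
  · exact Finset.prod_congr rfl fun i hi => if_neg (by have := Finset.mem_range.1 hi; omega)
  · exact Finset.prod_congr rfl fun i _ => by simp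

theorem norm_pow_mul_sub_pow_mul_le {z w : ℂ} (hz : ‖z‖ ≤ 1) (hw : ‖w‖ ≤ 1) (a b : ℕ) :
    ‖z ^ (a * b) - w ^ (a * b)‖ ≤ b * ‖z ^ a - w ^ a‖ := by
  rw [pow_mul, pow_mul, ← Commute.geom_sum₂_mul (Commute.all _ _), norm_mul]
  refine mul_le_mul_of_nonneg_right ?_ (norm_nonneg _)
  refine (norm_sum_le _ _).trans ?_
  refine (Finset.sum_le_card_nsmul _ _ 1 fun i _ => ?_).trans (by simp)
  rw [norm_mul, norm_pow, norm_pow, norm_pow, norm_pow]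
  exact mul_le_one₀ (pow_le_one₀ (by positivity) (pow_le_one₀ (norm_nonneg _) hz)) (by positivity)
    (pow_le_one₀ (by positivity) (pow_le_one₀ (norm_nonneg _) hw))

theorem norm_pow_mul_sub_one_le {z : ℂ} (hz : ‖z‖ ≤ 1) (a b : ℕ) :
    ‖z ^ (a * b) - 1‖ ≤ b * ‖z ^ a - 1‖ := by
  simpa using norm_pow_mul_sub_pow_mul_le hz norm_one.le a b

theorem norm_pow_sub_one_le_two {z : ℂ} (hz : ‖z‖ ≤ 1) (n : ℕ) : ‖z ^ n - 1‖ ≤ 2 := by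
  refine (norm_sub_le _ _).trans ?_
  rw [norm_pow, norm_one]
  linarith [pow_le_one₀ (n := n) (norm_nonneg _) hz]

/-! ### Products of distances to the points of a Leja section -/

section Sections

variable {n : ℕ} {E : ℕ → ℂ}

theorem IsLejaSection.prod_norm_sub (h : IsLejaSection (2 ^ n) E) (z : ℂ) :
    ∏ j ∈ Finset.range (2 ^ n), ‖z - E j‖ = ‖z ^ 2 ^ n - 1‖ := by
  rw [← norm_prod, h.prod_sub]

/-- This is the modulus of the derivative of `z ^ 2 ^ n - 1` at one of its roots. -/
theorem IsLejaSection.prod_erase_self (h : IsLejaSection (2 ^ n) E) {j : ℕ} (hj : j < 2 ^ n) :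
    ∏ i ∈ (Finset.range (2 ^ n)).erase j, ‖E j - E i‖ = 2 ^ n := by
  have hp : Lagrange.nodal (Finset.range (2 ^ n)) E = Polynomial.X ^ 2 ^ n - 1 :=
    Polynomial.funext fun z => by simp [Lagrange.eval_nodal, h.prod_sub]
  have := Lagrange.eval_nodal_derivative_eval_node_eq (v := E) (Finset.mem_range.2 hj)
  rw [hp, Lagrange.eval_nodal] at this
  rw [← norm_prod, ← this, Polynomial.derivative_sub, Polynomial.derivative_X_pow]
  simp [h.norm_eq_one hj]

theorem IsLejaSection.prod_erase_le (h : IsLejaSection (2 ^ n) E) {j : ℕ} (hj : j < 2 ^ n) {z : ℂ}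
    (hz : ‖z‖ ≤ 1) :
    ∏ i ∈ (Finset.range (2 ^ n)).erase j, ‖z - E i‖ ≤ 2 ^ n := by
  rcases eq_or_ne z (E j) with rfl | hne
  · exact (h.prod_erase_self hj).le
  have hpos : 0 < ‖z - E j‖ := norm_pos_iff.2 (sub_ne_zero.2 hne)
  refine le_of_mul_le_mul_left ?_ hpos
  rw [Finset.mul_prod_erase _ (fun i => ‖z - E i‖) (Finset.mem_range.2 hj), h.prod_norm_sub]
  have := norm_pow_mul_sub_pow_mul_le hz (h.norm_eq_one hj).le 1 (2 ^ n)
  rw [one_mul, h.pow_two_pow_eq_one hj, pow_one, pow_one] at this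
  push_cast at this
  linarith

/-- The polynomial with zeros at the first `r` points of a Leja section is, on the unit circle,
under control from above everywhere, from below away from the roots of unity of a suitable order,
and relative to its derivative at its zeros. -/
theorem IsLejaSection.prod_norm_bounds (h : IsLejaSection (2 ^ n) E) {r : ℕ} (hr : 1 ≤ r)
    (hrn : r < 2 ^ n) :
    ∃ B : ℝ, 0 < B ∧ ∃ t : ℕ, 2 ^ t ≤ r ∧
      (∀ z : ℂ, ‖z‖ = 1 → ∏ i ∈ Finset.range r, ‖z - E i‖ ≤ B) ∧
      (∀ u : ℂ, ‖u‖ = 1 →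
        B * ‖u ^ (2 ^ t * 2) - 1‖ ≤ 4 * 2 ^ t * ∏ i ∈ Finset.range r, ‖u - E i‖) ∧
      ∀ j < r, ∀ z : ℂ, ‖z‖ = 1 →
        ∏ i ∈ (Finset.range r).erase j, ‖z - E i‖
          ≤ 2 ^ t * ∏ i ∈ (Finset.range r).erase j, ‖E j - E i‖ := by
  induction n generalizing E r with
  | zero => simp at hrn; omega
  | succ n ih =>
    have h2n : 1 ≤ 2 ^ n := Nat.one_le_two_pow
    have h2n' : (2 : ℕ) ^ (n + 1) = 2 ^ n + 2 ^ n := by rw [pow_succ, mul_two]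
    rw [h2n'] at h hrn
    rcases lt_or_ge r (2 ^ n) with hlt | hge
    · exact ih (h.mono (by omega)) hr hlt
    have hE := h.mono (m := 2 ^ n) (by omega)
    obtain ⟨q, rfl⟩ := Nat.exists_eq_add_of_le hge
    have hdouble : ∀ u : ℂ, ‖u‖ = 1 → ‖u ^ (2 ^ n * 2) - 1‖ ≤ 2 * ‖u ^ 2 ^ n - 1‖ := fun u hu => by
      simpa using norm_pow_mul_sub_one_le hu.le (2 ^ n) 2
    have hD : (1 : ℝ) ≤ 2 ^ n := one_le_pow₀ one_le_two
    rcases Nat.eq_zero_or_pos q with rfl | hq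
    · refine ⟨2, two_pos, n, le_rfl, fun z hz => ?_, fun u hu => ?_, fun j hj z hz => ?_⟩
      · rw [add_zero, hE.prod_norm_sub]
        exact norm_pow_sub_one_le_two hz.le _
      · rw [add_zero, hE.prod_norm_sub]
        have := hdouble u hu
        nlinarith [norm_nonneg (u ^ 2 ^ n - 1)]
      · rw [add_zero] at hj ⊢
        rw [hE.prod_erase_self hj]
        refine (hE.prod_erase_le hj hz.le).trans ?_
        nlinarith
    have hq' : q < 2 ^ n := by omega
    have hE1 := h.mono (m := 2 ^ n + 1) (by omega)
    have hs : IsLejaSection (2 ^ n) (_root_.lejaShift n E) := h.lejaShift h2n le_rfl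
    set ρ := E (2 ^ n) with hρdef
    have hρ : ρ ^ 2 ^ n = -1 := hE1.pow_two_pow_eq_neg_one
    have hρ1 : ‖ρ‖ = 1 := hE1.norm_two_pow
    have hρ0 : ρ ≠ 0 := by intro h0; simp [h0] at hρ1
    have hEF := hE1.add_eq_mul_lejaShift
    rw [← hρdef] at hEF
    set F := _root_.lejaShift n E with hF
    -- The recursion strips the leading binary digit of `r = 2 ^ n + q`: the witness `t` is the
    -- position of that digit, and `B` doubles with each digit `1`.
    obtain ⟨B, hB, t, htq, hup, hlow, hder⟩ := ih hs hq hq'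
    have hnz : ∀ z : ℂ, ‖z‖ = 1 → ‖z / ρ‖ = 1 := fun z hz => by rw [norm_div, hz, hρ1, div_one]
    have hfac : ∀ (z : ℂ) (i : ℕ), ‖z - E (2 ^ n + i)‖ = ‖z / ρ - F i‖ := fun z i => by
      rw [hEF i, show z - ρ * F i = ρ * (z / ρ - F i) by field_simp, norm_mul, hρ1, one_mul]
    have htn : t < n := by
      by_contra hcon
      have : 2 ^ n ≤ 2 ^ t := Nat.pow_le_pow_right two_pos (by omega)
      omega
    have hexp : 2 ^ n = 2 ^ t * 2 * 2 ^ (n - t - 1) := by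
      rw [mul_assoc, ← pow_succ', ← pow_add]; congr 1; omega
    have hexpR : (2 : ℝ) ^ n = 2 ^ t * 2 * 2 ^ (n - t - 1) := by exact_mod_cast hexp
    -- Since `ρ ^ 2 ^ n = -1`, the left side is `‖(u / ρ) ^ 2 ^ n - 1‖`, and `2 ^ (t + 1)` divides
    -- `2 ^ n` because `t < n`.
    have hroot : ∀ u : ℂ, ‖u‖ = 1 →
        ‖u ^ 2 ^ n + 1‖ ≤ 2 ^ (n - t - 1) * ‖(u / ρ) ^ (2 ^ t * 2) - 1‖ := fun u hu => by
      have := norm_pow_mul_sub_one_le (hnz u hu).le (2 ^ t * 2) (2 ^ (n - t - 1))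
      rw [← hexp, div_pow, hρ] at this
      push_cast at this
      refine le_trans (le_of_eq ?_) this
      rw [← norm_neg]; congr 1; ring
    have hlow' : ∀ u : ℂ, ‖u‖ = 1 →
        B * ‖u ^ 2 ^ n + 1‖ ≤ 2 * 2 ^ n * ∏ i ∈ Finset.range q, ‖u / ρ - F i‖ := fun u hu => by
      calc B * ‖u ^ 2 ^ n + 1‖
          ≤ B * (2 ^ (n - t - 1) * ‖(u / ρ) ^ (2 ^ t * 2) - 1‖) :=
            mul_le_mul_of_nonneg_left (hroot u hu) hB.le
        _ = 2 ^ (n - t - 1) * (B * ‖(u / ρ) ^ (2 ^ t * 2) - 1‖) := by ring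
        _ ≤ 2 ^ (n - t - 1) * (4 * 2 ^ t * ∏ i ∈ Finset.range q, ‖u / ρ - F i‖) :=
            mul_le_mul_of_nonneg_left (hlow _ (hnz u hu)) (by positivity)
        _ = _ := by rw [hexpR]; ring
    refine ⟨2 * B, by positivity, n, by omega, fun z hz => ?_, fun u hu => ?_, fun j hj z hz => ?_⟩
    · rw [Finset.prod_range_add, hE.prod_norm_sub]
      simp only [hfac]
      exact mul_le_mul (norm_pow_sub_one_le_two hz.le _) (hup _ (hnz z hz))
        (Finset.prod_nonneg fun _ _ => norm_nonneg _) zero_le_two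
    · rw [Finset.prod_range_add, hE.prod_norm_sub]
      simp only [hfac]
      rw [show u ^ (2 ^ n * 2) - 1 = (u ^ 2 ^ n - 1) * (u ^ 2 ^ n + 1) by rw [pow_mul]; ring,
        norm_mul]
      have := mul_le_mul_of_nonneg_left (hlow' u hu) (norm_nonneg (u ^ 2 ^ n - 1))
      nlinarith
    -- At a node of the first half `‖u ^ 2 ^ n + 1‖ = 2`, so `hlow'` bounds the tail from below by
    -- `B / 2 ^ n`. At a node of the second half the first factor has its maximal value `2`, and the
    -- induction hypothesis controls the tail.
    · rcases lt_or_ge j (2 ^ n) with hj1 | hj1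
      · rw [Finset.prod_range_add_erase_of_lt _ hj1, Finset.prod_range_add_erase_of_lt _ hj1,
          hE.prod_erase_self hj1]
        simp only [hfac]
        have h1 := hlow' (E j) (hE.norm_eq_one hj1)
        rw [hE.pow_two_pow_eq_one hj1, show ‖(1 : ℂ) + 1‖ = 2 by norm_num] at h1
        have h2 : ∏ i ∈ (Finset.range (2 ^ n)).erase j, ‖z - E i‖ ≤ 2 ^ n :=
          hE.prod_erase_le hj1 hz.le
        refine (mul_le_mul h2 (hup _ (hnz z hz)) (Finset.prod_nonneg fun _ _ => norm_nonneg _)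
          (by positivity)).trans ?_
        refine mul_le_mul_of_nonneg_left ?_ (by positivity)
        linarith
      · obtain ⟨i, rfl⟩ := Nat.exists_eq_add_of_le hj1
        rw [Finset.prod_range_add_erase_add, Finset.prod_range_add_erase_add, hE.prod_norm_sub,
          hE.prod_norm_sub]
        simp only [hfac]
        have hi : F i ^ 2 ^ n = 1 := hs.pow_two_pow_eq_one (by omega)
        rw [hEF i, mul_pow, hρ, hi, mul_one, show ‖(-1 : ℂ) - 1‖ = 2 by norm_num,
          mul_div_cancel_left₀ _ hρ0]
        have h1 := hder i (by omega) _ (hnz z hz)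
        have h2 : (2 : ℝ) ^ t ≤ 2 ^ n := pow_le_pow_right₀ one_le_two htn.le
        have h3 : 0 ≤ ∏ k ∈ (Finset.range q).erase i, ‖F i - F k‖ :=
          Finset.prod_nonneg fun _ _ => norm_nonneg _
        calc _ ≤ 2 * (2 ^ t * ∏ k ∈ (Finset.range q).erase i, ‖F i - F k‖) :=
              mul_le_mul (norm_pow_sub_one_le_two hz.le _) h1
                (Finset.prod_nonneg fun _ _ => norm_nonneg _) zero_le_two
          _ ≤ 2 * (2 ^ n * ∏ k ∈ (Finset.range q).erase i, ‖F i - F k‖) := by gcongr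
          _ = _ := by ring

end Sections

/-! ### Real parts of points on the unit circle -/

theorem IsLejaSequence.norm_eq_one {E : ℕ → ℂ} (h : IsLejaSequence E) (j : ℕ) : ‖E j‖ = 1 :=
  (h.isLejaSection (2 ^ j)).norm_eq_one Nat.lt_two_pow_self

theorem Complex.conj_mul_self_of_norm_eq_one {z : ℂ} (hz : ‖z‖ = 1) : conj z * z = 1 := by
  rw [mul_comm, Complex.mul_conj, Complex.normSq_eq_norm_sq, hz]; norm_num

theorem Complex.conj_eq_neg_of_sq_eq_neg_one {c : ℂ} (hc : c ^ 2 = -1) : conj c = -c := by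
  have h1 := Complex.conj_mul_self_of_norm_eq_one (norm_eq_one_of_pow_eq_neg_one two_ne_zero hc)
  have hc0 : c ≠ 0 := by rintro rfl; norm_num at hc
  refine mul_right_cancel₀ hc0 ?_
  rw [h1]; linear_combination hc

theorem Complex.eq_or_eq_conj_of_re_eq {z w : ℂ} (hz : ‖z‖ = 1) (hw : ‖w‖ = 1)
    (h : z.re = w.re) : z = w ∨ z = conj w := by
  have h1 : Complex.normSq z = Complex.normSq w := by
    rw [Complex.normSq_eq_norm_sq, Complex.normSq_eq_norm_sq, hz, hw]
  rw [Complex.normSq_apply, Complex.normSq_apply, h] at h1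
  have h2 : z.im * z.im = w.im * w.im := by linarith
  rcases mul_self_eq_mul_self_iff.1 h2 with h3 | h3
  · exact Or.inl (Complex.ext h h3)
  · exact Or.inr (Complex.ext (by simpa using h) (by simpa using h3))

/-- On the circle `conj z = 1 / z`, so `(z - e) * (conj z - e) = -2 * e * (Re z - Re e)`. This
identity carries all real estimates over to complex ones and is why each real distance comes with a
factor `2`. -/
theorem Complex.two_mul_abs_re_sub_re {z e : ℂ} (hz : ‖z‖ = 1) (he : ‖e‖ = 1) :
    2 * |z.re - e.re| = ‖z - e‖ * ‖conj z - e‖ := by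
  have h1 := Complex.conj_mul_self_of_norm_eq_one hz
  have h2 := Complex.conj_mul_self_of_norm_eq_one he
  have h3 : (z - e) * (conj z - e) = -e * ((2 * (z.re - e.re) : ℝ) : ℂ) := by
    have h4 := Complex.add_conj z
    have h5 := Complex.add_conj e
    push_cast at h4 h5 ⊢
    linear_combination h1 - h2 - e * h4 + e * h5
  rw [← norm_mul, h3, norm_mul, norm_neg, he, one_mul, Complex.norm_real, Real.norm_eq_abs,
    abs_mul, abs_two]

theorem Complex.norm_conj_sub_eq (z w : ℂ) : ‖conj z - w‖ = ‖z - conj w‖ := by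
  rw [← Complex.norm_conj (z - conj w)]; simp

theorem Complex.norm_sq_sub_one_eq {z : ℂ} (hz : ‖z‖ = 1) : ‖z ^ 2 - 1‖ = ‖conj z - z‖ := by
  have h1 := Complex.conj_mul_self_of_norm_eq_one hz
  rw [show z ^ 2 - 1 = -(z * (conj z - z)) by linear_combination h1, norm_neg, norm_mul, hz,
    one_mul]

theorem Complex.norm_sq_sub_one_le {z : ℂ} (hz : ‖z‖ = 1) (e : ℂ) :
    ‖z ^ 2 - 1‖ ≤ ‖z - e‖ + ‖conj z - e‖ := by
  rw [Complex.norm_sq_sub_one_eq hz, add_comm, ← norm_sub_rev e z]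
  exact norm_sub_le_norm_sub_add_norm_sub _ _ _

/-! ### First occurrences among the real parts of a Leja sequence -/

/-- An explicit enumeration of the first occurrences in the real parts of a Leja sequence. -/
def reLejaIndex (k : ℕ) : ℕ :=
  if k ≤ 1 then k else (k - 1) + 2 ^ Nat.log 2 (k - 1)

theorem reLejaIndex_two_pow_add {n j : ℕ} (hj : j < 2 ^ n) :
    reLejaIndex (2 ^ n + 1 + j) = 2 ^ (n + 1) + j := by
  have h1 : 1 ≤ 2 ^ n := Nat.one_le_two_pow
  have h2 : Nat.log 2 (2 ^ n + j) = n :=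
    (Nat.log_eq_iff (by right; constructor <;> omega)).2 ⟨by omega, by rw [pow_succ]; omega⟩
  rw [reLejaIndex, if_neg (by omega), show 2 ^ n + 1 + j - 1 = 2 ^ n + j by omega, h2, pow_succ]
  omega

theorem exists_eq_two_pow_add {k : ℕ} (hk : 2 ≤ k) : ∃ n, ∃ j < 2 ^ n, k = 2 ^ n + 1 + j := by
  have h1 := Nat.pow_log_le_self 2 (show k - 1 ≠ 0 by omega)
  have h2 := Nat.lt_pow_succ_log_self one_lt_two (k - 1)
  rw [pow_succ] at h2
  exact ⟨Nat.log 2 (k - 1), k - 1 - 2 ^ Nat.log 2 (k - 1), by omega, by omega⟩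

theorem strictMono_reLejaIndex : StrictMono reLejaIndex := by
  refine strictMono_nat_of_lt_succ fun k => ?_
  rcases Nat.lt_or_ge k 2 with hk | hk
  · interval_cases k <;> simp [reLejaIndex]
  · have : 2 ^ Nat.log 2 (k - 1) ≤ 2 ^ Nat.log 2 k :=
      Nat.pow_le_pow_right two_pos (Nat.log_mono_right (by omega))
    rw [reLejaIndex, if_neg (by omega), reLejaIndex, if_neg (by omega), Nat.add_sub_cancel]
    omega

namespace IsLejaSequence

variable {E : ℕ → ℂ}

theorem apply_one (h : IsLejaSequence E) : E 1 = -1 := by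
  simpa using (h.isLejaSection (2 ^ 0 + 1)).pow_two_pow_eq_neg_one

theorem isLejaSection_lejaShift (h : IsLejaSequence E) (n : ℕ) :
    IsLejaSection (2 ^ n) (lejaShift n E) :=
  (h.isLejaSection (2 ^ n + 2 ^ n)).lejaShift Nat.one_le_two_pow le_rfl

theorem add_eq_mul_lejaShift (h : IsLejaSequence E) (n j : ℕ) :
    E (2 ^ n + j) = E (2 ^ n) * lejaShift n E j :=
  (h.isLejaSection _).add_eq_mul_lejaShift j

theorem two_pow_pow (h : IsLejaSequence E) (n : ℕ) : E (2 ^ n) ^ 2 ^ n = -1 :=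
  (h.isLejaSection _).pow_two_pow_eq_neg_one

theorem add_pow_eq_neg_one (h : IsLejaSequence E) {n j : ℕ} (hj : j < 2 ^ n) :
    E (2 ^ n + j) ^ 2 ^ n = -1 := by
  rw [h.add_eq_mul_lejaShift, mul_pow, h.two_pow_pow,
    (h.isLejaSection_lejaShift n).pow_two_pow_eq_one hj, mul_one]

theorem two_pow_succ_pow_sq (h : IsLejaSequence E) (n : ℕ) :
    (E (2 ^ (n + 1)) ^ 2 ^ n) ^ 2 = -1 := by
  rw [← pow_mul, ← pow_succ]; exact h.two_pow_pow (n + 1)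

theorem add_pow_eq (h : IsLejaSequence E) {n j : ℕ} (hj : j < 2 ^ n) :
    E (2 ^ (n + 1) + j) ^ 2 ^ n = E (2 ^ (n + 1)) ^ 2 ^ n := by
  have hle : 2 ^ n ≤ 2 ^ (n + 1) := Nat.pow_le_pow_right two_pos (by omega)
  rw [h.add_eq_mul_lejaShift, mul_pow,
    ((h.isLejaSection_lejaShift (n + 1)).mono hle).pow_two_pow_eq_one hj, mul_one]

theorem conj_add_pow_eq (h : IsLejaSequence E) {n j : ℕ} (hj : j < 2 ^ n) :
    conj (E (2 ^ (n + 1) + j)) ^ 2 ^ n = -E (2 ^ (n + 1)) ^ 2 ^ n := by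
  rw [← map_pow, h.add_pow_eq hj, Complex.conj_eq_neg_of_sq_eq_neg_one (h.two_pow_succ_pow_sq n)]

/-- An earlier point with the same real part would be the conjugate. Before the block, points have
power `1` to the exponent `2 ^ (n + 1)`, the conjugate has `-1`. Within the half block, points share
one power `c` to the exponent `2 ^ n`, with `c ^ 2 = -1`, whereas the conjugate has power `-c`. -/
theorem re_ne_re (h : IsLejaSequence E) {n j i : ℕ} (hj : j < 2 ^ n)
    (hi : i < 2 ^ (n + 1) + j) : (E i).re ≠ (E (2 ^ (n + 1) + j)).re := by
  intro hre
  rcases Complex.eq_or_eq_conj_of_re_eq (h.norm_eq_one _) (h.norm_eq_one _) hre with heq | heq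
  · exact (h.isLejaSection (2 ^ (n + 1) + j + 1)).ne hi (by omega) heq.symm
  rcases lt_or_ge i (2 ^ (n + 1)) with hlt | hge
  · have h1 := (h.isLejaSection (2 ^ (n + 1))).pow_two_pow_eq_one hlt
    have hle : 2 ^ n ≤ 2 ^ (n + 1) := Nat.pow_le_pow_right two_pos (by omega)
    rw [heq, ← map_pow, h.add_pow_eq_neg_one (hj.trans_le hle)] at h1
    norm_num at h1
  · obtain ⟨l, rfl⟩ := Nat.exists_eq_add_of_le hge
    have h1 := h.add_pow_eq (n := n) (j := l) (by omega)
    rw [heq, h.conj_add_pow_eq hj] at h1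
    have h2 := h.two_pow_succ_pow_sq n
    have h3 : E (2 ^ (n + 1)) ^ 2 ^ n = 0 := by linear_combination (-1 / 2 : ℂ) * h1
    rw [h3] at h2
    norm_num at h2

/-- In the second half of the block, the conjugate divided by `ρ` is a root of unity of order `2 ^
n`, hence listed in the first half of the shifted section. -/
theorem exists_re_eq (h : IsLejaSequence E) {n j : ℕ} (hj : j < 2 ^ n) :
    ∃ i < 2 ^ (n + 1) + (2 ^ n + j), (E i).re = (E (2 ^ (n + 1) + (2 ^ n + j))).re := by
  set ρ := E (2 ^ (n + 1)) with hρ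
  have hsec := h.isLejaSection_lejaShift (n + 1)
  have hle : 2 ^ n ≤ 2 ^ (n + 1) := Nat.pow_le_pow_right two_pos (by omega)
  have hsec0 := hsec.mono hle
  have h2 := h.two_pow_succ_pow_sq n
  have hc0 : ρ ^ 2 ^ n ≠ 0 := by
    intro h0; rw [← hρ, h0] at h2; norm_num at h2
  have hρ0 : ρ ≠ 0 := by
    intro h0; exact hc0 (by rw [h0, zero_pow (by positivity)])
  have h3 : lejaShift (n + 1) E (2 ^ n + j) ^ 2 ^ n = -1 := by
    have h4 := hsec.mono (m := 2 ^ n + 1) (by rw [pow_succ]; have := Nat.one_le_two_pow (n := n); omega)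
    have h5 := (hsec.mono (m := 2 ^ n + 2 ^ n) (by rw [pow_succ]; omega)).lejaShift
      Nat.one_le_two_pow le_rfl
    rw [h4.add_eq_mul_lejaShift, mul_pow, h4.pow_two_pow_eq_neg_one, h5.pow_two_pow_eq_one hj,
      mul_one]
  have h4 : conj (E (2 ^ (n + 1) + (2 ^ n + j))) ^ 2 ^ n = ρ ^ 2 ^ n := by
    rw [← map_pow, h.add_eq_mul_lejaShift, mul_pow, h3, map_mul,
      Complex.conj_eq_neg_of_sq_eq_neg_one h2]
    simp [hρ]
  obtain ⟨i, hi, hEi⟩ := hsec0.exists_eq_of_pow_eq_one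
    (z := conj (E (2 ^ (n + 1) + (2 ^ n + j))) / ρ) (by rw [div_pow, h4, div_self hc0])
  refine ⟨2 ^ (n + 1) + i, by omega, ?_⟩
  rw [h.add_eq_mul_lejaShift _ i, hEi, ← hρ, mul_div_cancel₀ _ hρ0, Complex.conj_re]

theorem range_reLejaIndex (h : IsLejaSequence E) :
    Set.range reLejaIndex = {k : ℕ | ∀ j < k, (E j).re ≠ (E k).re} := by
  ext k
  constructor
  · rintro ⟨l, rfl⟩ i hi
    rcases lt_or_ge l 2 with hl | hl
    · interval_cases l
      · simp [reLejaIndex] at hi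
      · simp only [reLejaIndex, le_refl, if_true, Nat.lt_one_iff] at hi ⊢
        subst hi
        rw [h.apply_one, h.1]; norm_num
    · obtain ⟨n, j, hj, rfl⟩ := exists_eq_two_pow_add hl
      rw [reLejaIndex_two_pow_add hj] at hi ⊢
      exact h.re_ne_re hj hi
  · intro hk
    rcases lt_or_ge k 2 with hl | hl
    · exact ⟨k, by rw [reLejaIndex, if_pos (by omega)]⟩
    obtain ⟨m, hm1, hm2⟩ : ∃ m, 2 ^ (m + 1) ≤ k ∧ k < 2 ^ (m + 2) := by
      have h1 := Nat.log_pos one_lt_two hl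
      refine ⟨Nat.log 2 k - 1, ?_, ?_⟩
      · rw [Nat.sub_add_cancel h1]; exact Nat.pow_log_le_self 2 (by omega)
      · rw [show Nat.log 2 k - 1 + 2 = (Nat.log 2 k).succ by omega]
        exact Nat.lt_pow_succ_log_self one_lt_two k
    obtain ⟨i, rfl⟩ := Nat.exists_eq_add_of_le hm1
    rcases lt_or_ge i (2 ^ m) with hi | hi
    · exact ⟨_, reLejaIndex_two_pow_add hi⟩
    · obtain ⟨j, rfl⟩ := Nat.exists_eq_add_of_le hi
      obtain ⟨l, hl, hre⟩ := h.exists_re_eq (n := m) (j := j) (by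
        rw [pow_add 2 m 2, pow_succ] at hm2; omega)
      exact absurd hre (hk l hl)

end IsLejaSequence

/-! ### Node polynomials of the real projection -/

/-- `X` lists the real parts of the Leja sequence `E` along `reLejaIndex`. -/
structure IsRealProjection (E : ℕ → ℂ) (X : ℕ → ℝ) : Prop where
  isLejaSequence : IsLejaSequence E
  apply_eq : ∀ k, X k = (E (reLejaIndex k)).re

theorem IsReLejaSequence.exists_isRealProjection {X : ℕ → ℝ} (h : IsReLejaSequence X) :
    ∃ E, IsRealProjection E X := by
  obtain ⟨E, hE, φ, hφ, hr, hX⟩ := h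
  have : φ = reLejaIndex :=
    (hφ.range_inj strictMono_reLejaIndex).1 (hr.trans hE.range_reLejaIndex.symm)
  exact ⟨E, hE, fun k => by rw [hX, this]⟩

theorem IsRealProjection.injective {E : ℕ → ℂ} {X : ℕ → ℝ} (h : IsRealProjection E X) :
    Function.Injective X := by
  have hne : ∀ a b, a < b → X a ≠ X b := fun a b hab => by
    have h1 : reLejaIndex b ∈ {k : ℕ | ∀ j < k, (E j).re ≠ (E k).re} := by
      rw [← h.isLejaSequence.range_reLejaIndex]; exact ⟨b, rfl⟩
    rw [h.apply_eq, h.apply_eq]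
    exact h1 _ (strictMono_reLejaIndex hab)
  intro a b hab
  rcases lt_trichotomy a b with hlt | heq | hlt
  · exact absurd hab (hne a b hlt)
  · exact heq
  · exact absurd hab.symm (hne b a hlt)

theorem IsRealProjection.mem_Icc {E : ℕ → ℂ} {X : ℕ → ℝ} (h : IsRealProjection E X) (k : ℕ) :
    X k ∈ Set.Icc (-1 : ℝ) 1 := by
  rw [h.apply_eq, Set.mem_Icc, ← abs_le]
  exact (Complex.abs_re_le_norm _).trans (h.isLejaSequence.norm_eq_one _).le

theorem Complex.exists_norm_eq_one_re_eq {x : ℝ} (hx : x ∈ Set.Icc (-1 : ℝ) 1) :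
    ∃ z : ℂ, ‖z‖ = 1 ∧ z.re = x :=
  ⟨Complex.exp (Real.arccos x * Complex.I), Complex.norm_exp_ofReal_mul_I _, by
    rw [Complex.exp_ofReal_mul_I_re, Real.cos_arccos hx.1 hx.2]⟩

theorem Complex.norm_sub_mul_conj_sub_of_sq_eq_neg_one {w c : ℂ} (hw : ‖w‖ = 1) (hc : c ^ 2 = -1) :
    ‖w - c‖ * ‖conj w - c‖ = ‖w ^ 2 + 1‖ := by
  have h1 := Complex.conj_mul_self_of_norm_eq_one hw
  have hc1 : ‖c‖ = 1 := norm_eq_one_of_pow_eq_neg_one two_ne_zero hc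
  have h2 : w * ((w - c) * (conj w - c)) = -c * (w ^ 2 + 1) := by
    linear_combination (w - c) * h1 + w * hc
  have h3 := congrArg norm h2
  rwa [norm_mul, hw, one_mul, norm_mul, norm_mul, norm_neg, hc1, one_mul] at h3

namespace IsRealProjection

variable {E : ℕ → ℂ} {X : ℕ → ℝ}

theorem apply_zero (h : IsRealProjection E X) : X 0 = 1 := by
  rw [h.apply_eq]; simp [reLejaIndex, h.isLejaSequence.1]

theorem apply_one (h : IsRealProjection E X) : X 1 = -1 := by
  rw [h.apply_eq]; simp [reLejaIndex, h.isLejaSequence.apply_one]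

theorem apply_add (h : IsRealProjection E X) {n j : ℕ} (hj : j < 2 ^ n) :
    X (2 ^ n + 1 + j) = (E (2 ^ (n + 1) + j)).re := by
  rw [h.apply_eq, reLejaIndex_two_pow_add hj]

theorem exists_root (h : IsRealProjection E X) {n i : ℕ} (hi : i < 2 ^ n + 1) :
    ∃ u : ℂ, X i = u.re ∧ ‖u‖ = 1 ∧ u ^ 2 ^ (n + 1) = 1 := by
  rcases lt_or_ge i 2 with hl | hl
  · interval_cases i
    · exact ⟨1, by simp [h.apply_zero], by simp, by simp⟩
    · exact ⟨-1, by simp [h.apply_one], by simp, by rw [pow_succ, mul_comm, pow_mul]; simp⟩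
  · obtain ⟨m, j, hj, rfl⟩ := exists_eq_two_pow_add hl
    refine ⟨_, h.apply_add hj, h.isLejaSequence.norm_eq_one _, ?_⟩
    have hmn : m < n := by
      by_contra hcon
      have : 2 ^ n ≤ 2 ^ m := Nat.pow_le_pow_right two_pos (by omega)
      omega
    have h1 := (h.isLejaSequence.isLejaSection (2 ^ (m + 2))).pow_two_pow_eq_one
      (j := 2 ^ (m + 1) + j) (by rw [pow_add 2 m 2, pow_succ]; omega)
    rw [show 2 ^ (n + 1) = 2 ^ (m + 2) * 2 ^ (n - m - 1) by rw [← pow_add]; congr 1; omega, pow_mul,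
      h1, one_pow]

variable (E) in
/-- The product of the distances to the `q` points of a Leja sequence that follow the first
`2 ^ (n + 1)` ones. -/
noncomputable def lejaTail (n q : ℕ) (z : ℂ) : ℝ :=
  ∏ j ∈ Finset.range q, ‖z - E (2 ^ (n + 1) + j)‖

theorem lejaTail_nonneg (n q : ℕ) (z : ℂ) : 0 ≤ lejaTail E n q z :=
  Finset.prod_nonneg fun _ _ => norm_nonneg _

theorem norm_sub_add (h : IsRealProjection E X) (n : ℕ) (z : ℂ) (j : ℕ) :
    ‖z - E (2 ^ (n + 1) + j)‖
      = ‖z / E (2 ^ (n + 1)) - lejaShift (n + 1) E j‖ := by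
  have h1 := h.isLejaSequence.norm_eq_one (2 ^ (n + 1))
  have h0 : E (2 ^ (n + 1)) ≠ 0 := by intro h0; simp [h0] at h1
  rw [h.isLejaSequence.add_eq_mul_lejaShift,
    show z - E (2 ^ (n + 1)) * lejaShift (n + 1) E j
      = E (2 ^ (n + 1)) * (z / E (2 ^ (n + 1)) - lejaShift (n + 1) E j) by field_simp,
    norm_mul, h1, one_mul]

theorem two_mul_abs_sub (h : IsRealProjection E X) {n j : ℕ} (hj : j < 2 ^ n) {z : ℂ}
    (hz : ‖z‖ = 1) :
    2 * |z.re - X (2 ^ n + 1 + j)|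
      = ‖z - E (2 ^ (n + 1) + j)‖ * ‖conj z - E (2 ^ (n + 1) + j)‖ := by
  rw [h.apply_add hj, Complex.two_mul_abs_re_sub_re hz (h.isLejaSequence.norm_eq_one _)]

theorem prod_tail (h : IsRealProjection E X) {n q : ℕ} (hq : q ≤ 2 ^ n) {z : ℂ} (hz : ‖z‖ = 1) :
    ∏ j ∈ Finset.range q, (2 * |z.re - X (2 ^ n + 1 + j)|)
      = lejaTail E n q z * lejaTail E n q (conj z) := by
  rw [lejaTail, lejaTail, ← Finset.prod_mul_distrib]
  exact Finset.prod_congr rfl fun j hj =>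
    h.two_mul_abs_sub ((Finset.mem_range.1 hj).trans_le hq) hz

theorem lejaTail_two_pow (h : IsRealProjection E X) (n : ℕ) (z : ℂ) :
    lejaTail E n (2 ^ n) z = ‖z ^ 2 ^ n - E (2 ^ (n + 1)) ^ 2 ^ n‖ := by
  have h1 := h.isLejaSequence.norm_eq_one (2 ^ (n + 1))
  have h0 : E (2 ^ (n + 1)) ≠ 0 := by intro h0; simp [h0] at h1
  have hsec := (h.isLejaSequence.isLejaSection_lejaShift (n + 1)).mono
    (Nat.pow_le_pow_right two_pos (Nat.le_succ n))
  simp only [lejaTail, h.norm_sub_add]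
  rw [hsec.prod_norm_sub, div_pow, div_sub_one (pow_ne_zero _ h0), norm_div, norm_pow (E _), h1,
    one_pow, div_one]

theorem prod_tail_two_pow (h : IsRealProjection E X) (n : ℕ) {z : ℂ} (hz : ‖z‖ = 1) :
    ∏ j ∈ Finset.range (2 ^ n), (2 * |z.re - X (2 ^ n + 1 + j)|) = ‖z ^ 2 ^ (n + 1) + 1‖ := by
  rw [h.prod_tail le_rfl hz, h.lejaTail_two_pow, h.lejaTail_two_pow, ← map_pow,
    Complex.norm_sub_mul_conj_sub_of_sq_eq_neg_one (by rw [norm_pow, hz, one_pow])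
      (h.isLejaSequence.two_pow_succ_pow_sq n), ← pow_mul, ← pow_succ]

/-- These nodes are the real parts of the roots of unity of order `2 ^ (n + 1)`. A conjugate pair of
roots yields one node with both factors; `1` and `-1` are their own conjugates and occur squared,
whence the extra `‖z ^ 2 - 1‖`. -/
theorem prod_two_pow_add_one (h : IsRealProjection E X) (n : ℕ) {z : ℂ} (hz : ‖z‖ = 1) :
    ∏ j ∈ Finset.range (2 ^ n + 1), (2 * |z.re - X j|) = ‖z ^ 2 - 1‖ * ‖z ^ 2 ^ (n + 1) - 1‖ := by
  induction n with
  | zero =>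
    have h1 := Complex.two_mul_abs_re_sub_re hz (norm_one (α := ℂ))
    have h2 := Complex.two_mul_abs_re_sub_re (e := -1) hz (by simp)
    have h3 : ‖conj z - 1‖ = ‖z - 1‖ := by rw [Complex.norm_conj_sub_eq, map_one]
    have h4 : ‖conj z - -1‖ = ‖z - -1‖ := by rw [Complex.norm_conj_sub_eq, map_neg, map_one]
    rw [h3, Complex.one_re] at h1
    rw [h4, Complex.neg_re, Complex.one_re] at h2
    rw [pow_zero, zero_add, pow_one, Finset.prod_range_succ, Finset.prod_range_one, h.apply_zero,
      h.apply_one, h1, h2, show z ^ 2 - 1 = (z - 1) * (z - -1) by ring, norm_mul]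
    ring
  | succ n ih =>
    rw [show 2 ^ (n + 1) + 1 = 2 ^ n + 1 + 2 ^ n by rw [pow_succ]; ring, Finset.prod_range_add, ih,
      h.prod_tail_two_pow n hz, mul_assoc, ← norm_mul]
    congr 2
    rw [pow_succ 2 (n + 1), pow_mul]; ring

/-- At the point `e` of the node, the factor `‖e ^ 2 - 1‖ = ‖conj e - e‖` from the earlier nodes is
exactly the one missing from the tail at `conj e`. -/
theorem prod_erase_tail (h : IsRealProjection E X) {n q j : ℕ} (hq : q ≤ 2 ^ n) (hj : j < q) :
    ∏ i ∈ (Finset.range (2 ^ n + 1 + q)).erase (2 ^ n + 1 + j),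
        (2 * |X (2 ^ n + 1 + j) - X i|)
      = 2 * (∏ i ∈ (Finset.range q).erase j,
          ‖E (2 ^ (n + 1) + j) - E (2 ^ (n + 1) + i)‖)
        * lejaTail E n q (conj (E (2 ^ (n + 1) + j))) := by
  have hj' := hj.trans_le hq
  have hle : 2 ^ n ≤ 2 ^ (n + 1) := Nat.pow_le_pow_right two_pos (Nat.le_succ n)
  have he := h.isLejaSequence.norm_eq_one (2 ^ (n + 1) + j)
  have hpow := h.isLejaSequence.add_pow_eq_neg_one (hj'.trans_le hle)
  rw [Finset.prod_range_add_erase_add, h.apply_add hj']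
  set e := E (2 ^ (n + 1) + j) with hedef
  have h1 : ∏ i ∈ (Finset.range q).erase j, (2 * |e.re - X (2 ^ n + 1 + i)|)
      = (∏ i ∈ (Finset.range q).erase j, ‖e - E (2 ^ (n + 1) + i)‖)
        * ∏ i ∈ (Finset.range q).erase j, ‖conj e - E (2 ^ (n + 1) + i)‖ := by
    rw [← Finset.prod_mul_distrib]
    refine Finset.prod_congr rfl fun i hi => h.two_mul_abs_sub ?_ he
    exact (Finset.mem_range.1 (Finset.mem_of_mem_erase hi)).trans_le hq
  rw [h.prod_two_pow_add_one n he, hpow, Complex.norm_sq_sub_one_eq he, h1, lejaTail,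
    ← Finset.mul_prod_erase _ (fun i => ‖conj e - E (2 ^ (n + 1) + i)‖) (Finset.mem_range.2 hj),
    ← hedef, show ‖(-1 : ℂ) - 1‖ = 2 by norm_num]
  ring

/-- Each new block multiplies the product at an old node by exactly `2`. Equality holds except at
the endpoints `1` and `-1`, where the product is twice as large. -/
theorem prod_erase_two_pow_add_one (h : IsRealProjection E X) (n : ℕ) {i : ℕ}
    (hi : i < 2 ^ n + 1) :
    2 ^ (n + 1) ≤ ∏ j ∈ (Finset.range (2 ^ n + 1)).erase i, (2 * |X i - X j|) := by
  induction n generalizing i with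
  | zero =>
    simp only [pow_zero] at hi ⊢
    interval_cases i
    · rw [show (Finset.range (1 + 1)).erase 0 = {1} by decide, Finset.prod_singleton, h.apply_zero,
        h.apply_one]
      norm_num
    · rw [show (Finset.range (1 + 1)).erase 1 = {0} by decide, Finset.prod_singleton, h.apply_zero,
        h.apply_one]
      norm_num
  | succ n ih =>
    have hsplit : 2 ^ (n + 1) + 1 = 2 ^ n + 1 + 2 ^ n := by rw [pow_succ]; ring
    rw [hsplit] at hi ⊢
    rcases lt_or_ge i (2 ^ n + 1) with hlt | hge
    · obtain ⟨u, hu, hu1, hupow⟩ := h.exists_root hlt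
      rw [Finset.prod_range_add_erase_of_lt _ hlt]
      have h1 : ∏ j ∈ Finset.range (2 ^ n), (2 * |X i - X (2 ^ n + 1 + j)|) = 2 := by
        rw [hu, h.prod_tail_two_pow n hu1, hupow]; norm_num
      rw [h1, pow_succ]
      exact mul_le_mul_of_nonneg_right (ih hlt) zero_le_two
    · obtain ⟨j, rfl⟩ := Nat.exists_eq_add_of_le hge
      have hj : j < 2 ^ n := by omega
      have hsec := (h.isLejaSequence.isLejaSection_lejaShift (n + 1)).mono
        (Nat.pow_le_pow_right two_pos (Nat.le_succ n))
      have h1 := h.isLejaSequence.norm_eq_one (2 ^ (n + 1))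
      have h0 : E (2 ^ (n + 1)) ≠ 0 := by intro h0; simp [h0] at h1
      have hc1 : ‖E (2 ^ (n + 1)) ^ 2 ^ n‖ = 1 := by rw [norm_pow, h1, one_pow]
      rw [h.prod_erase_tail le_rfl hj, h.lejaTail_two_pow, h.isLejaSequence.conj_add_pow_eq hj]
      simp only [h.norm_sub_add]
      rw [h.isLejaSequence.add_eq_mul_lejaShift, mul_div_cancel_left₀ _ h0,
        hsec.prod_erase_self hj, ← neg_add', norm_neg, ← two_mul, norm_mul, hc1]
      apply le_of_eq
      rw [pow_succ, pow_succ]; norm_num; ring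

theorem exists_lejaTail_bounds (h : IsRealProjection E X) {n q : ℕ} (hq : q < 2 ^ n) :
    ∃ B : ℝ, 0 < B ∧ (∀ z : ℂ, ‖z‖ = 1 → lejaTail E n q z ≤ B) ∧
      (∀ u : ℂ, ‖u‖ = 1 → u ^ 2 ^ (n + 1) = 1 → B ≤ 2 ^ (n + 1) * lejaTail E n q u) ∧
      (∀ j < q, B ≤ 2 ^ (n + 1) * lejaTail E n q (conj (E (2 ^ (n + 1) + j)))) ∧
      ∀ j < q, ∀ z : ℂ, ‖z‖ = 1 →
        ∏ i ∈ (Finset.range q).erase j, ‖z - E (2 ^ (n + 1) + i)‖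
          ≤ 2 ^ (n + 1) * ∏ i ∈ (Finset.range q).erase j,
            ‖E (2 ^ (n + 1) + j) - E (2 ^ (n + 1) + i)‖ := by
  rcases Nat.eq_zero_or_pos q with rfl | hq0
  · refine ⟨1, one_pos, by simp [lejaTail], fun u _ _ => ?_, by simp, by simp⟩
    simpa [lejaTail] using one_le_pow₀ (M₀ := ℝ) one_le_two
  set ρ := E (2 ^ (n + 1)) with hρdef
  have hρ1 : ‖ρ‖ = 1 := h.isLejaSequence.norm_eq_one (2 ^ (n + 1))
  have hρ0 : ρ ≠ 0 := by intro h0; simp [h0] at hρ1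
  have hρ : ρ ^ 2 ^ (n + 1) = -1 := h.isLejaSequence.two_pow_pow (n + 1)
  have hsec := (h.isLejaSequence.isLejaSection_lejaShift (n + 1)).mono
    (Nat.pow_le_pow_right two_pos (Nat.le_succ n))
  obtain ⟨B, hB, t, htq, hup, hlow, hder⟩ := hsec.prod_norm_bounds hq0 hq
  have htn : t < n := by
    by_contra hcon
    have : 2 ^ n ≤ 2 ^ t := Nat.pow_le_pow_right two_pos (by omega)
    omega
  have hnz : ∀ z : ℂ, ‖z‖ = 1 → ‖z / ρ‖ = 1 := fun z hz => by rw [norm_div, hz, hρ1, div_one]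
  have hexp : ∀ m, t < m → 2 ^ m = 2 ^ t * 2 * 2 ^ (m - t - 1) := fun m hm => by
    rw [mul_assoc, ← pow_succ', ← pow_add]; congr 1; omega
  -- The condition keeps `(u / ρ) ^ 2 ^ (t + 1)` away from `1`, which makes the lower bound of
  -- `prod_norm_bounds` effective. It is used with `m = n + 1` at the old nodes and with `m = n` at
  -- the conjugates of the new ones.
  have hlow' : ∀ m, t < m → m ≤ n + 1 → ∀ u : ℂ, ‖u‖ = 1 → (u / ρ) ^ 2 ^ m = -1 →
      B ≤ 2 ^ (n + 1) * lejaTail E n q u := fun m htm hmn u hu hum => by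
    have h1 := norm_pow_mul_sub_one_le (hnz u hu).le (2 ^ t * 2) (2 ^ (m - t - 1))
    rw [← hexp m htm, hum, show ‖(-1 : ℂ) - 1‖ = 2 by norm_num] at h1
    have h2 := hlow _ (hnz u hu)
    have h3 : (2 : ℝ) ^ m = 2 ^ t * 2 * 2 ^ (m - t - 1) := by exact_mod_cast hexp m htm
    push_cast at h1
    simp only [lejaTail, h.norm_sub_add]
    set P := ∏ i ∈ Finset.range q, ‖u / ρ - lejaShift (n + 1) E i‖ with hP
    have hP0 : 0 ≤ P := Finset.prod_nonneg fun _ _ => norm_nonneg _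
    have h4 : B * 2 ≤ 2 ^ (m - t - 1) * (4 * 2 ^ t * P) := by
      calc B * 2 ≤ B * (2 ^ (m - t - 1) * ‖(u / ρ) ^ (2 ^ t * 2) - 1‖) :=
            mul_le_mul_of_nonneg_left h1 hB.le
        _ = 2 ^ (m - t - 1) * (B * ‖(u / ρ) ^ (2 ^ t * 2) - 1‖) := by ring
        _ ≤ _ := mul_le_mul_of_nonneg_left h2 (by positivity)
    have h5 : (2 : ℝ) ^ m * P ≤ 2 ^ (n + 1) * P :=
      mul_le_mul_of_nonneg_right (pow_le_pow_right₀ one_le_two hmn) hP0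
    rw [h3] at h5
    linarith
  refine ⟨B, hB, fun z hz => ?_, fun u hu hupow => ?_, fun j hj => ?_, fun j hj z hz => ?_⟩
  · simp only [lejaTail, h.norm_sub_add]
    exact hup _ (hnz z hz)
  · refine hlow' (n + 1) (by omega) le_rfl u hu ?_
    rw [div_pow, hupow, hρ]; norm_num
  · have hc0 : ρ ^ 2 ^ n ≠ 0 := pow_ne_zero _ hρ0
    refine hlow' n htn (by omega) _ ?_ ?_
    · rw [Complex.norm_conj]; exact h.isLejaSequence.norm_eq_one _
    · rw [div_pow, h.isLejaSequence.conj_add_pow_eq (hj.trans hq), ← hρdef, neg_div, div_self hc0]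
  · simp only [h.norm_sub_add]
    rw [h.isLejaSequence.add_eq_mul_lejaShift, ← hρdef, mul_div_cancel_left₀ _ hρ0]
    refine (hder j hj _ (hnz z hz)).trans ?_
    refine mul_le_mul_of_nonneg_right (pow_le_pow_right₀ one_le_two (by omega)) ?_
    exact Finset.prod_nonneg fun _ _ => norm_nonneg _

theorem prod_erase_le_of_lt (h : IsRealProjection E X) {n q i : ℕ} (hq : q < 2 ^ n)
    (hi : i < 2 ^ n + 1) {z : ℂ} (hz : ‖z‖ = 1) :
    ∏ j ∈ Finset.range (2 ^ n + 1 + q), (2 * |z.re - X j|)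
      ≤ 2 * |z.re - X i| * (2 * (2 ^ (n + 1)) ^ 2 *
        ∏ j ∈ (Finset.range (2 ^ n + 1 + q)).erase i, (2 * |X i - X j|)) := by
  obtain ⟨B, hB, hup, hlow, -, -⟩ := h.exists_lejaTail_bounds hq
  obtain ⟨u, hu, hu1, hupow⟩ := h.exists_root hi
  have hden := h.prod_erase_two_pow_add_one n hi
  rw [Finset.prod_range_add_erase_of_lt _ hi, Finset.prod_range_add, h.prod_two_pow_add_one n hz,
    h.prod_tail hq.le hz]
  set A := ∏ j ∈ (Finset.range (2 ^ n + 1)).erase i, (2 * |X i - X j|)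
  rw [hu, h.prod_tail hq.le hu1, Complex.two_mul_abs_re_sub_re hz hu1]
  have hcz : ‖conj z‖ = 1 := by rw [Complex.norm_conj, hz]
  have hcu : ‖conj u‖ = 1 := by rw [Complex.norm_conj, hu1]
  have h1 := hup z hz
  have h2 := hup _ hcz
  have h3 := hlow u hu1 hupow
  have h4 := hlow _ hcu (by rw [← map_pow, hupow, map_one])
  have h5 := Complex.norm_sq_sub_one_le hz u
  have h6 : ‖z ^ 2 ^ (n + 1) - 1‖ ≤ 2 ^ (n + 1) * ‖z - u‖ := by
    simpa [hupow] using norm_pow_mul_sub_pow_mul_le hz.le hu1.le 1 (2 ^ (n + 1))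
  have h7 : ‖z ^ 2 ^ (n + 1) - 1‖ ≤ 2 ^ (n + 1) * ‖conj z - u‖ := by
    rw [Complex.norm_conj_sub_eq]
    simpa [← map_pow, hupow] using norm_pow_mul_sub_pow_mul_le hz.le hcu.le 1 (2 ^ (n + 1))
  set d : ℝ := 2 ^ (n + 1) with hd
  have hd0 : 0 < d := by positivity
  set a := ‖z - u‖
  set b := ‖conj z - u‖
  set w := ‖z ^ 2 ^ (n + 1) - 1‖
  set s := ‖z ^ 2 - 1‖
  have ha : 0 ≤ a := norm_nonneg _
  have hb : 0 ≤ b := norm_nonneg _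
  have hw : 0 ≤ w := norm_nonneg _
  -- Since `s ≤ a + b` and `w` is at most both `d * a` and `d * b`, both factors `a` and `b` of the
  -- erased node split off. The factor `d` lost here is regained from `hden`.
  have h8 : s * w ≤ 2 * d * (a * b) := by
    calc s * w ≤ (a + b) * w := mul_le_mul_of_nonneg_right h5 hw
      _ = a * w + b * w := by ring
      _ ≤ a * (d * b) + b * (d * a) := by gcongr
      _ = _ := by ring
  have h9 : lejaTail E n q z * lejaTail E n q (conj z)
      ≤ (d * lejaTail E n q u) * (d * lejaTail E n q (conj u)) :=
    mul_le_mul (h1.trans h3) (h2.trans h4) (lejaTail_nonneg _ _ _)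
      (mul_nonneg hd0.le (lejaTail_nonneg _ _ _))
  have hT : 0 ≤ lejaTail E n q u * lejaTail E n q (conj u) :=
    mul_nonneg (lejaTail_nonneg _ _ _) (lejaTail_nonneg _ _ _)
  calc s * w * (lejaTail E n q z * lejaTail E n q (conj z))
      ≤ (2 * d * (a * b)) * ((d * lejaTail E n q u) * (d * lejaTail E n q (conj u))) :=
        mul_le_mul h8 h9 (mul_nonneg (lejaTail_nonneg _ _ _) (lejaTail_nonneg _ _ _))
          (by positivity)
    _ = (a * b * (2 * d ^ 2) * (lejaTail E n q u * lejaTail E n q (conj u))) * d := by ring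
    _ ≤ (a * b * (2 * d ^ 2) * (lejaTail E n q u * lejaTail E n q (conj u))) * A :=
        mul_le_mul_of_nonneg_left hden (by positivity)
    _ = _ := by ring

theorem prod_erase_le_of_ge (h : IsRealProjection E X) {n q j : ℕ} (hq : q < 2 ^ n)
    (hj : j < q) {z : ℂ} (hz : ‖z‖ = 1) :
    ∏ i ∈ Finset.range (2 ^ n + 1 + q), (2 * |z.re - X i|)
      ≤ 2 * |z.re - X (2 ^ n + 1 + j)| * (2 * (2 ^ (n + 1)) ^ 2 *
        ∏ i ∈ (Finset.range (2 ^ n + 1 + q)).erase (2 ^ n + 1 + j),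
          (2 * |X (2 ^ n + 1 + j) - X i|)) := by
  obtain ⟨B, hB, hup, -, hlow, hder⟩ := h.exists_lejaTail_bounds hq
  rw [h.prod_erase_tail hq.le hj, Finset.prod_range_add, h.prod_two_pow_add_one n hz,
    h.prod_tail hq.le hz, h.two_mul_abs_sub (hj.trans hq) hz]
  have hcz : ‖conj z‖ = 1 := by rw [Complex.norm_conj, hz]
  have h1 := hup z hz
  have h2 := hup _ hcz
  have h3 := hlow j hj
  have h4 := hder j hj z hz
  have h5 := hder j hj _ hcz
  have h6 := Complex.norm_sq_sub_one_le hz (E (2 ^ (n + 1) + j))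
  have h7 := norm_pow_sub_one_le_two hz.le (2 ^ (n + 1))
  have hfac : ∀ y, lejaTail E n q y = ‖y - E (2 ^ (n + 1) + j)‖ *
      ∏ i ∈ (Finset.range q).erase j, ‖y - E (2 ^ (n + 1) + i)‖ := fun y =>
    (Finset.mul_prod_erase _ (fun i => ‖y - E (2 ^ (n + 1) + i)‖) (Finset.mem_range.2 hj)).symm
  have hz1 := hfac z
  have hz2 := hfac (conj z)
  set T := lejaTail E n q (conj (E (2 ^ (n + 1) + j)))
  set Tz := lejaTail E n q z
  set Tc := lejaTail E n q (conj z)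
  have hTz : 0 ≤ Tz := lejaTail_nonneg _ _ _
  have hTc : 0 ≤ Tc := lejaTail_nonneg _ _ _
  set D := ∏ i ∈ (Finset.range q).erase j, ‖E (2 ^ (n + 1) + j) - E (2 ^ (n + 1) + i)‖
  set Dz := ∏ i ∈ (Finset.range q).erase j, ‖z - E (2 ^ (n + 1) + i)‖
  set Dc := ∏ i ∈ (Finset.range q).erase j, ‖conj z - E (2 ^ (n + 1) + i)‖
  have hD : 0 ≤ D := Finset.prod_nonneg fun _ _ => norm_nonneg _
  have hDz : 0 ≤ Dz := Finset.prod_nonneg fun _ _ => norm_nonneg _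
  have hDc : 0 ≤ Dc := Finset.prod_nonneg fun _ _ => norm_nonneg _
  set d : ℝ := 2 ^ (n + 1) with hd
  have hd0 : 0 < d := by positivity
  set a := ‖z - E (2 ^ (n + 1) + j)‖
  set b := ‖conj z - E (2 ^ (n + 1) + j)‖
  set w := ‖z ^ 2 ^ (n + 1) - 1‖
  set s := ‖z ^ 2 - 1‖
  have ha : 0 ≤ a := norm_nonneg _
  have hb : 0 ≤ b := norm_nonneg _
  have hw : 0 ≤ w := norm_nonneg _
  have h8 : Tz * Dc ≤ d * T * (d * D) := mul_le_mul (h1.trans h3) h5 hDc (hB.le.trans h3)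
  have h9 : Dz * Tc ≤ d * D * (d * T) := mul_le_mul h4 (h2.trans h3) hTc (by positivity)
  have hTT : 0 ≤ Tz * Tc := mul_nonneg hTz hTc
  -- After `s ≤ a + b`, each summand supplies one of the factors `a`, `b`; the other is taken out of
  -- the tail at `conj z` or at `z` respectively.
  calc s * w * (Tz * Tc) ≤ (a + b) * 2 * (Tz * Tc) :=
        mul_le_mul_of_nonneg_right (mul_le_mul h6 h7 hw (by positivity)) hTT
    _ = 2 * (a * (Tz * Tc) + b * (Tz * Tc)) := by ring
    _ = 2 * (a * (Tz * (b * Dc)) + b * ((a * Dz) * Tc)) := by rw [← hz1, ← hz2]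
    _ = 2 * (a * b) * (Tz * Dc + Dz * Tc) := by ring
    _ ≤ 2 * (a * b) * (d * T * (d * D) + d * D * (d * T)) := by gcongr
    _ = _ := by ring

theorem prod_erase_le (h : IsRealProjection E X) {k i : ℕ} (hi : i ≤ k) {x : ℝ}
    (hx : x ∈ Set.Icc (-1 : ℝ) 1) :
    ∏ j ∈ (Finset.range (k + 1)).erase i, |x - X j|
      ≤ 8 * ((k : ℝ) + 1) ^ 2 * ∏ j ∈ (Finset.range (k + 1)).erase i, |X i - X j| := by
  have hk1 : (1 : ℝ) ≤ (k : ℝ) + 1 := by linarith [Nat.cast_nonneg (α := ℝ) k]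
  have hk8 : 1 ≤ 8 * ((k : ℝ) + 1) ^ 2 := by nlinarith
  rcases eq_or_ne x (X i) with rfl | hne
  · exact le_mul_of_one_le_left (Finset.prod_nonneg fun _ _ => abs_nonneg _) hk8
  rcases Nat.eq_zero_or_pos k with rfl | hk
  · obtain rfl : i = 0 := by omega
    simp
  obtain ⟨n, q, hq, hkn⟩ := exists_eq_two_pow_add (k := k + 1) (by omega)
  -- This turns the factor `2 * (2 ^ (n + 1)) ^ 2` of `key` into `8 * (k + 1) ^ 2`.
  have hdk : (2 : ℝ) ^ (n + 1) ≤ 2 * ((k : ℝ) + 1) := by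
    have : 2 ^ (n + 1) ≤ 2 * (k + 1) := by rw [pow_succ]; omega
    exact_mod_cast this
  obtain ⟨z, hz, rfl⟩ := Complex.exists_norm_eq_one_re_eq hx
  have key : ∏ j ∈ Finset.range (k + 1), (2 * |z.re - X j|)
      ≤ 2 * |z.re - X i| * (2 * (2 ^ (n + 1)) ^ 2 *
        ∏ j ∈ (Finset.range (k + 1)).erase i, (2 * |X i - X j|)) := by
    have hi' : i < k + 1 := by omega
    rw [hkn] at hi' ⊢
    rcases lt_or_ge i (2 ^ n + 1) with hlt | hge
    · exact h.prod_erase_le_of_lt hq hlt hz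
    · obtain ⟨j, rfl⟩ := Nat.exists_eq_add_of_le hge
      exact h.prod_erase_le_of_ge hq (by omega) hz
  have hpos : 0 < 2 * |z.re - X i| := mul_pos two_pos (abs_pos.2 (sub_ne_zero.2 hne))
  rw [← Finset.mul_prod_erase _ (fun j => 2 * |z.re - X j|) (Finset.mem_range.2 (by omega : i < k + 1))]
    at key
  have key2 := le_of_mul_le_mul_left key hpos
  rw [Finset.prod_mul_distrib, Finset.prod_mul_distrib, mul_left_comm] at key2
  have key3 := le_of_mul_le_mul_left key2 (by
    rw [Finset.prod_const]; positivity)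
  refine key3.trans (mul_le_mul_of_nonneg_right ?_ (Finset.prod_nonneg fun _ _ => abs_nonneg _))
  have hd0 : (0 : ℝ) ≤ 2 ^ (n + 1) := by positivity
  nlinarith

end IsRealProjection

/-! ### Unisolvence and Lebesgue constants from a Lagrange basis -/

section LagrangeBasis

variable {N d : ℕ} {A : Set (Fin N → ℝ)} {ι : Type*} [Fintype ι] {x : ι → A}
  {g : ι → MvPolynomial (Fin N) ℝ}

theorem totalDegree_sum_C_mul_le (hdeg : ∀ i, (g i).totalDegree ≤ d) (c : ι → ℝ) :
    (∑ i, MvPolynomial.C (c i) * g i).totalDegree ≤ d := by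
  refine MvPolynomial.totalDegree_finsetSum_le fun i _ => ?_
  refine (MvPolynomial.totalDegree_mul _ _).trans ?_
  rw [MvPolynomial.totalDegree_C, zero_add]
  exact hdeg i

variable [DecidableEq ι]

theorem eval_sum_C_mul
    (hg : ∀ i j, MvPolynomial.eval (x j : Fin N → ℝ) (g i) = if i = j then 1 else 0)
    (c : ι → ℝ) (j : ι) :
    MvPolynomial.eval (x j : Fin N → ℝ) (∑ i, MvPolynomial.C (c i) * g i) = c j := by
  simp [hg]

/-- The dual polynomials make evaluation at the nodes surjective; equality of dimensions makes it
injective. -/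
theorem isUnisolvent_of_lagrangeBasis (hx : Function.Surjective x)
    (hdeg : ∀ i, (g i).totalDegree ≤ d)
    (hg : ∀ i j, MvPolynomial.eval (x j : Fin N → ℝ) (g i) = if i = j then 1 else 0)
    (hcard : Module.finrank ℝ (MvPolynomial.restrictTotalDegree (Fin N) ℝ d) = Fintype.card ι) :
    IsUnisolvent d A := by
  have hsurj : Function.Surjective ((LinearMap.funLeft ℝ ℝ x) ∘ₗ evalOn d A) := by
    intro c
    refine ⟨⟨_, (MvPolynomial.mem_restrictTotalDegree _ _ _).2 (totalDegree_sum_C_mul_le hdeg c)⟩, ?_⟩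
    funext j
    exact eval_sum_C_mul hg c j
  have hinj := (LinearMap.injective_iff_surjective_of_finrank_eq_finrank
    (hcard.trans (Module.finrank_fintype_fun_eq_card ℝ).symm)).2 hsurj
  intro f
  refine ⟨∑ i, MvPolynomial.C (f (x i)) * g i, ⟨totalDegree_sum_C_mul_le hdeg _, fun a => ?_⟩, ?_⟩
  · obtain ⟨i, rfl⟩ := hx a
    exact eval_sum_C_mul hg _ i
  · rintro p ⟨hp, hpf⟩
    have h1 := @hinj ⟨p, (MvPolynomial.mem_restrictTotalDegree _ _ _).2 hp⟩
      ⟨_, (MvPolynomial.mem_restrictTotalDegree _ _ _).2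
        (totalDegree_sum_C_mul_le hdeg fun i => f (x i))⟩ (by
        funext j
        exact (hpf (x j)).trans (eval_sum_C_mul hg (fun i => f (x i)) j).symm)
    exact congrArg Subtype.val h1

theorem lebesgueConstant_le_of_lagrangeBasis (hx : Function.Surjective x)
    (hdeg : ∀ i, (g i).totalDegree ≤ d)
    (hg : ∀ i j, MvPolynomial.eval (x j : Fin N → ℝ) (g i) = if i = j then 1 else 0)
    {K : Set (Fin N → ℝ)} [CompactSpace K] (hAK : A ⊆ K) (h : IsUnisolvent d A) {M : ℝ}
    (hM0 : 0 ≤ M) (hM : ∀ y ∈ K, ∑ i, |MvPolynomial.eval y (g i)| ≤ M) :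
    lebesgueConstant hAK h ≤ M := by
  refine ContinuousLinearMap.opNorm_le_bound _ hM0 fun f => ?_
  rw [ContinuousMap.norm_le _ (by positivity)]
  intro y
  have hint : interpolant h (valuesOn hAK f)
      = ∑ i, MvPolynomial.C (valuesOn hAK f (x i)) * g i := by
    refine (h (valuesOn hAK f)).unique (interpolant_spec h _)
      ⟨totalDegree_sum_C_mul_le hdeg _, fun a => ?_⟩
    obtain ⟨i, rfl⟩ := hx a
    exact eval_sum_C_mul hg _ i
  have hval : lagrangeOperator hAK h f y
      = ∑ i, valuesOn hAK f (x i) * MvPolynomial.eval (y : Fin N → ℝ) (g i) := by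
    change MvPolynomial.eval (y : Fin N → ℝ) (interpolant h (valuesOn hAK f)) = _
    rw [hint]; simp
  rw [hval]
  calc ‖∑ i, valuesOn hAK f (x i) * MvPolynomial.eval (y : Fin N → ℝ) (g i)‖
      ≤ ∑ i, ‖f‖ * |MvPolynomial.eval (y : Fin N → ℝ) (g i)| := by
        refine (norm_sum_le _ _).trans (Finset.sum_le_sum fun i _ => ?_)
        rw [norm_mul, Real.norm_eq_abs (MvPolynomial.eval _ _)]
        exact mul_le_mul_of_nonneg_right (f.norm_coe_le_norm _) (abs_nonneg _)
    _ ≤ M * ‖f‖ := by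
        rw [← Finset.mul_sum, mul_comm]
        exact mul_le_mul_of_nonneg_right (hM y y.2) (norm_nonneg _)

end LagrangeBasis

/-! ### Multi-indices and polynomials of bounded total degree -/

/-- The multi-indices of length at most `k`. -/
def multiIndices (N k : ℕ) : Finset (Fin N → ℕ) :=
  (Fintype.piFinset fun _ => Finset.range (k + 1)).filter fun α => ∑ j, α j ≤ k

theorem mem_multiIndices {N k : ℕ} {α : Fin N → ℕ} : α ∈ multiIndices N k ↔ ∑ j, α j ≤ k := by
  rw [multiIndices, Finset.mem_filter, Fintype.mem_piFinset, and_iff_right_iff_imp]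
  intro h j
  exact Finset.mem_range.2
    (Nat.lt_succ_of_le ((Finset.single_le_sum (fun _ _ => Nat.zero_le _) (Finset.mem_univ j)).trans h))

theorem multiIndices_subset (N k : ℕ) :
    multiIndices N k ⊆ Fintype.piFinset fun _ => Finset.range (k + 1) :=
  Finset.filter_subset _ _

theorem card_multiIndices_le (N k : ℕ) : (multiIndices N k).card ≤ (k + 1) ^ N := by
  refine (Finset.card_le_card (multiIndices_subset N k)).trans ?_
  simp

theorem finrank_restrictTotalDegree (N k : ℕ) :
    Module.finrank ℝ (MvPolynomial.restrictTotalDegree (Fin N) ℝ k)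
      = Fintype.card (multiIndices N k) := by
  rw [← Nat.card_eq_fintype_card]
  refine (Module.finrank_eq_nat_card_basis (MvPolynomial.basisRestrictSupport ℝ
    {n : Fin N →₀ ℕ | (n.sum fun _ e => e) ≤ k})).trans ?_
  refine Nat.card_congr (Finsupp.equivFunOnFinite.subtypeEquiv fun n => ?_)
  rw [mem_multiIndices, Set.mem_ofPred_eq, Finsupp.sum_fintype _ _ fun _ => rfl]
  rfl

theorem MvPolynomial.totalDegree_aeval_X_le {σ R : Type*} [CommRing R] [Nontrivial R] (j : σ)
    (p : Polynomial R) :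
    (Polynomial.aeval (MvPolynomial.X j : MvPolynomial σ R) p).totalDegree ≤ p.natDegree := by
  rw [Polynomial.aeval_eq_sum_range]
  refine MvPolynomial.totalDegree_finsetSum_le fun i hi => ?_
  refine (MvPolynomial.totalDegree_smul_le _ _).trans ?_
  rw [MvPolynomial.totalDegree_X_pow]
  exact Nat.lt_succ_iff.1 (Finset.mem_range.1 hi)

theorem MvPolynomial.eval_aeval_X {σ R : Type*} [CommRing R] (y : σ → R) (j : σ)
    (p : Polynomial R) :
    MvPolynomial.eval y (Polynomial.aeval (MvPolynomial.X j : MvPolynomial σ R) p)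
      = p.eval (y j) := by
  induction p using Polynomial.induction_on' with
  | add p q hp hq => simp [hp, hq]
  | monomial n a => simp [Polynomial.aeval_monomial]

/-! ### Univariate Lagrange polynomials and their differences -/

section Univariate

open Polynomial

/-- The Lagrange polynomial of the node `X b` among the nodes `X 0, …, X (n - 1)`. -/
noncomputable def lagrangePoly (X : ℕ → ℝ) (n b : ℕ) : ℝ[X] :=
  -- The value `0` for `b ≥ n` lets the differences in `lagrangeDiff` telescope from the zero
  -- polynomial at `n = 0`.
  if b < n then Lagrange.basis (Finset.range n) X b else 0

variable {X : ℕ → ℝ}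

theorem natDegree_lagrangePoly_le (hX : Function.Injective X) (n b : ℕ) :
    (lagrangePoly X n b).natDegree ≤ n - 1 := by
  rw [lagrangePoly]
  split_ifs with hb
  · rw [Lagrange.natDegree_basis hX.injOn (Finset.mem_range.2 hb), Finset.card_range]
  · simp

theorem eval_lagrangePoly (hX : Function.Injective X) {n c : ℕ} (hc : c < n) (b : ℕ) :
    (lagrangePoly X n b).eval (X c) = if b = c then 1 else 0 := by
  rw [lagrangePoly]
  split_ifs with hb hbc hbc
  · subst hbc
    exact Lagrange.eval_basis_self hX.injOn (Finset.mem_range.2 hb)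
  · exact Lagrange.eval_basis_of_ne hbc (Finset.mem_range.2 hc)
  · omega
  · simp

/-- The contribution of the node `X b` to the difference of the interpolation polynomials at the
first `i + 1` and at the first `i` nodes. -/
noncomputable def lagrangeDiff (X : ℕ → ℝ) (i b : ℕ) : ℝ[X] :=
  lagrangePoly X (i + 1) b - lagrangePoly X i b

theorem natDegree_lagrangeDiff_le (hX : Function.Injective X) (i b : ℕ) :
    (lagrangeDiff X i b).natDegree ≤ i :=
  (natDegree_sub_le _ _).trans (max_le (natDegree_lagrangePoly_le hX _ _)
    ((natDegree_lagrangePoly_le hX _ _).trans (Nat.sub_le _ _)))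

theorem eval_lagrangeDiff_of_lt (hX : Function.Injective X) {c i : ℕ} (hc : c < i) (b : ℕ) :
    (lagrangeDiff X i b).eval (X c) = 0 := by
  rw [lagrangeDiff, eval_sub, eval_lagrangePoly hX (hc.trans i.lt_succ_self),
    eval_lagrangePoly hX hc, sub_self]

theorem sum_eval_lagrangeDiff (n b : ℕ) (y : ℝ) :
    ∑ i ∈ Finset.range n, (lagrangeDiff X i b).eval y = (lagrangePoly X n b).eval y := by
  simp only [lagrangeDiff, eval_sub]
  rw [Finset.sum_range_sub (fun i => (lagrangePoly X i b).eval y)]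
  simp [lagrangePoly]

theorem IsRealProjection.abs_eval_lagrangePoly_le {E : ℕ → ℂ} (h : IsRealProjection E X) {y : ℝ}
    (hy : y ∈ Set.Icc (-1 : ℝ) 1) (n b : ℕ) :
    |(lagrangePoly X n b).eval y| ≤ 8 * (n : ℝ) ^ 2 := by
  rw [lagrangePoly]
  split_ifs with hb
  · obtain ⟨k, rfl⟩ := Nat.exists_eq_succ_of_ne_zero (show n ≠ 0 by omega)
    have hpos : 0 < ∏ j ∈ (Finset.range (k + 1)).erase b, |X b - X j| :=
      Finset.prod_pos fun j hj => abs_pos.2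
        (sub_ne_zero.2 (h.injective.ne (Finset.ne_of_mem_erase hj).symm))
    have h1 := h.prod_erase_le (Nat.lt_succ_iff.1 hb) hy
    have h2 : |(Lagrange.basis (Finset.range (k + 1)) X b).eval y|
        = (∏ j ∈ (Finset.range (k + 1)).erase b, |y - X j|)
          / ∏ j ∈ (Finset.range (k + 1)).erase b, |X b - X j| := by
      rw [Lagrange.basis, eval_prod, Finset.abs_prod, ← Finset.prod_div_distrib]
      refine Finset.prod_congr rfl fun j _ => ?_
      rw [Lagrange.basisDivisor, eval_mul, eval_C, eval_sub, eval_X, eval_C, abs_mul, abs_inv,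
        inv_mul_eq_div]
    rw [Nat.succ_eq_add_one, h2, div_le_iff₀ hpos]
    push_cast
    exact h1
  · simp

theorem IsRealProjection.sum_abs_eval_lagrangePoly_le {E : ℕ → ℂ} (h : IsRealProjection E X)
    {y : ℝ} (hy : y ∈ Set.Icc (-1 : ℝ) 1) {n k : ℕ} (hn : n ≤ k + 1) :
    ∑ b ∈ Finset.range (k + 1), |(lagrangePoly X n b).eval y| ≤ 8 * ((k : ℝ) + 1) ^ 3 := by
  have hnk : (n : ℝ) ≤ (k : ℝ) + 1 := by exact_mod_cast hn
  refine (Finset.sum_le_card_nsmul _ _ (8 * ((k : ℝ) + 1) ^ 2) fun b _ => ?_).trans (le_of_eq ?_)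
  · refine (h.abs_eval_lagrangePoly_le hy n b).trans ?_
    gcongr
  · rw [Finset.card_range, nsmul_eq_mul]; push_cast; ring

theorem IsRealProjection.sum_abs_eval_lagrangeDiff_le {E : ℕ → ℂ} (h : IsRealProjection E X)
    {y : ℝ} (hy : y ∈ Set.Icc (-1 : ℝ) 1) {i k : ℕ} (hi : i ≤ k) :
    ∑ b ∈ Finset.range (k + 1), |(lagrangeDiff X i b).eval y| ≤ 16 * ((k : ℝ) + 1) ^ 3 := by
  have h1 := h.sum_abs_eval_lagrangePoly_le hy (n := i + 1) (k := k) (by omega)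
  have h2 := h.sum_abs_eval_lagrangePoly_le hy (n := i) (k := k) (by omega)
  calc _ ≤ ∑ b ∈ Finset.range (k + 1),
        (|(lagrangePoly X (i + 1) b).eval y| + |(lagrangePoly X i b).eval y|) := by
        refine Finset.sum_le_sum fun b _ => ?_
        rw [lagrangeDiff, eval_sub]
        exact abs_sub _ _
    _ ≤ _ := by rw [Finset.sum_add_distrib]; linarith

end Univariate

/-! ### Interpolation at the intertwining -/

section Intertwining

variable {N : ℕ} {X : Fin N → ℕ → ℝ}

/-- The point of the intertwining with a given multi-index. -/
def intertwiningPoint (X : Fin N → ℕ → ℝ) (k : ℕ) (α : multiIndices N k) : intertwining X k :=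
  ⟨fun j => X j (α.1 j), α.1, mem_multiIndices.1 α.2, rfl⟩

theorem intertwiningPoint_surjective (X : Fin N → ℕ → ℝ) (k : ℕ) :
    Function.Surjective (intertwiningPoint X k) := by
  rintro ⟨_, α, hα, rfl⟩
  exact ⟨⟨α, mem_multiIndices.2 hα⟩, rfl⟩

/-- The Lagrange polynomial of the intertwining at the point with multi-index `β`. -/
noncomputable def intertwiningPoly (X : Fin N → ℕ → ℝ) (k : ℕ) (β : Fin N → ℕ) :
    MvPolynomial (Fin N) ℝ :=
  -- Newton form: the full tensor product is expanded into univariate increments, and only those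
  -- with `|α| ≤ k` are kept.
  ∑ α ∈ multiIndices N k, ∏ j, Polynomial.aeval (MvPolynomial.X j) (lagrangeDiff (X j) (α j) (β j))

theorem totalDegree_intertwiningPoly_le (hX : ∀ j, Function.Injective (X j)) (k : ℕ)
    (β : Fin N → ℕ) : (intertwiningPoly X k β).totalDegree ≤ k := by
  refine MvPolynomial.totalDegree_finsetSum_le fun α hα => ?_
  refine (MvPolynomial.totalDegree_finsetProd _ _).trans ?_
  refine (Finset.sum_le_sum fun j _ => ?_).trans (mem_multiIndices.1 hα)
  exact (MvPolynomial.totalDegree_aeval_X_le _ _).trans (natDegree_lagrangeDiff_le (hX j) _ _)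

theorem eval_intertwiningPoly (k : ℕ) (β : Fin N → ℕ) (y : Fin N → ℝ) :
    MvPolynomial.eval y (intertwiningPoly X k β)
      = ∑ α ∈ multiIndices N k, ∏ j, (lagrangeDiff (X j) (α j) (β j)).eval (y j) := by
  simp [intertwiningPoly, MvPolynomial.eval_aeval_X]

/-- At the node `γ` only the terms with `α ≤ γ` survive. All of them occur in the sum because the
index set is downward closed, so the sum over this box factors and telescopes in each variable. -/
theorem eval_intertwiningPoly_node (hX : ∀ j, Function.Injective (X j)) (k : ℕ)
    (β : Fin N → ℕ) {γ : Fin N → ℕ} (hγ : γ ∈ multiIndices N k) :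
    MvPolynomial.eval (fun j => X j (γ j)) (intertwiningPoly X k β) = if β = γ then 1 else 0 := by
  rw [eval_intertwiningPoly]
  have hsub : (Fintype.piFinset fun j => Finset.range (γ j + 1)) ⊆ multiIndices N k := by
    intro α hα
    rw [Fintype.mem_piFinset] at hα
    exact mem_multiIndices.2 ((Finset.sum_le_sum fun j _ =>
      Nat.lt_succ_iff.1 (Finset.mem_range.1 (hα j))).trans (mem_multiIndices.1 hγ))
  rw [← Finset.sum_subset hsub, ← Finset.prod_univ_sum (fun j => Finset.range (γ j + 1))
    fun j i => (lagrangeDiff (X j) i (β j)).eval (X j (γ j))]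
  · simp only [sum_eval_lagrangeDiff, eval_lagrangePoly (hX _) (Nat.lt_succ_self _)]
    rw [Finset.prod_ite_zero]
    simp [funext_iff]
  · intro α _ hα
    rw [Fintype.mem_piFinset, not_forall] at hα
    obtain ⟨j, hj⟩ := hα
    refine Finset.prod_eq_zero (Finset.mem_univ j) (eval_lagrangeDiff_of_lt (hX j) ?_ _)
    rw [Finset.mem_range] at hj
    omega

theorem eval_intertwiningPoly_intertwiningPoint (hX : ∀ j, Function.Injective (X j)) (k : ℕ)
    (β γ : multiIndices N k) :
    MvPolynomial.eval (intertwiningPoint X k γ : Fin N → ℝ) (intertwiningPoly X k β.1)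
      = if β = γ then 1 else 0 := by
  refine (eval_intertwiningPoly_node hX k β.1 γ.2).trans ?_
  simp only [Subtype.ext_iff]

theorem isUnisolvent_intertwining (hX : ∀ j, Function.Injective (X j)) (k : ℕ) :
    IsUnisolvent k (intertwining X k) :=
  isUnisolvent_of_lagrangeBasis (intertwiningPoint_surjective X k)
    (g := fun β : multiIndices N k => intertwiningPoly X k β.1)
    (fun β => totalDegree_intertwiningPoly_le hX k β.1)
    (eval_intertwiningPoly_intertwiningPoint hX k)
    (finrank_restrictTotalDegree N k)

theorem intertwining_subset_Icc (hX : ∀ j k, X j k ∈ Set.Icc (-1 : ℝ) 1) (k : ℕ) :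
    intertwining X k ⊆ Set.Icc (-1) 1 := by
  rintro _ ⟨α, -, rfl⟩
  exact ⟨fun j => (hX j _).1, fun j => (hX j _).2⟩

theorem lebesgueConstant_intertwining_le {E : Fin N → ℕ → ℂ}
    (h : ∀ j, IsRealProjection (E j) (X j)) (k : ℕ)
    (hsub : intertwining X k ⊆ Set.Icc (-1) 1) (huni : IsUnisolvent k (intertwining X k)) :
    lebesgueConstant hsub huni ≤ (16 * ((k : ℝ) + 1) ^ 4) ^ N := by
  have hX := fun j => (h j).injective
  refine lebesgueConstant_le_of_lagrangeBasis (intertwiningPoint_surjective X k)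
    (g := fun β : multiIndices N k => intertwiningPoly X k β.1)
    (fun β => totalDegree_intertwiningPoly_le hX k β.1)
    (eval_intertwiningPoly_intertwiningPoint hX k)
    hsub huni (by positivity) fun y hy => ?_
  rw [Finset.sum_coe_sort (multiIndices N k)
    fun β => |MvPolynomial.eval y (intertwiningPoly X k β)|]
  calc ∑ β ∈ multiIndices N k, |MvPolynomial.eval y (intertwiningPoly X k β)|
      ≤ ∑ β ∈ multiIndices N k, ∑ α ∈ multiIndices N k,
          ∏ j, |(lagrangeDiff (X j) (α j) (β j)).eval (y j)| := by
        refine Finset.sum_le_sum fun β _ => ?_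
        rw [eval_intertwiningPoly]
        refine (Finset.abs_sum_le_sum_abs _ _).trans (Finset.sum_le_sum fun α _ => ?_)
        rw [Finset.abs_prod]
    _ = ∑ α ∈ multiIndices N k, ∑ β ∈ multiIndices N k,
          ∏ j, |(lagrangeDiff (X j) (α j) (β j)).eval (y j)| := Finset.sum_comm
    -- Enlarging the range of `β` to a box turns the sum of products into a product of univariate
    -- sums.
    _ ≤ ∑ α ∈ multiIndices N k, (16 * ((k : ℝ) + 1) ^ 3) ^ N := by
        refine Finset.sum_le_sum fun α hα => ?_
        refine (Finset.sum_le_sum_of_subset_of_nonneg (multiIndices_subset N k) fun _ _ _ =>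
          Finset.prod_nonneg fun _ _ => abs_nonneg _).trans ?_
        rw [← Finset.prod_univ_sum (fun _ => Finset.range (k + 1))
          fun j b => |(lagrangeDiff (X j) (α j) b).eval (y j)|]
        refine (Finset.prod_le_prod (fun j _ => Finset.sum_nonneg fun _ _ => abs_nonneg _)
          fun j _ => (h j).sum_abs_eval_lagrangeDiff_le ⟨hy.1 j, hy.2 j⟩ ?_).trans (by simp)
        exact Nat.lt_succ_iff.1 (Finset.mem_range.1
          (Fintype.mem_piFinset.1 (multiIndices_subset N k hα) j))
    _ ≤ ((k : ℝ) + 1) ^ N * (16 * ((k : ℝ) + 1) ^ 3) ^ N := by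
        rw [Finset.sum_const, nsmul_eq_mul]
        refine mul_le_mul_of_nonneg_right ?_ (by positivity)
        exact_mod_cast card_multiIndices_le N k
    _ = _ := by rw [← mul_pow]; congr 1; ring

/-- The general bound would give the exponent `4`, but only `(1 + 11 - 6) / 2 = 3` is allowed. Using
the Lagrange polynomials without splitting them into differences saves the sum over `α`. -/
theorem lebesgueConstant_intertwining_one_le {X : Fin 1 → ℕ → ℝ} {E : Fin 1 → ℕ → ℂ}
    (h : ∀ j, IsRealProjection (E j) (X j)) (k : ℕ)
    (hsub : intertwining X k ⊆ Set.Icc (-1) 1) (huni : IsUnisolvent k (intertwining X k)) :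
    lebesgueConstant hsub huni ≤ 8 * ((k : ℝ) + 1) ^ 3 := by
  have hX := fun j => (h j).injective
  have hlt : ∀ β ∈ multiIndices 1 k, β 0 < k + 1 := fun β hβ => by
    simpa using Nat.lt_succ_of_le (mem_multiIndices.1 hβ)
  refine lebesgueConstant_le_of_lagrangeBasis (intertwiningPoint_surjective X k)
    (g := fun β => Polynomial.aeval (MvPolynomial.X 0) (lagrangePoly (X 0) (k + 1) (β.1 0)))
    (fun β => (MvPolynomial.totalDegree_aeval_X_le _ _).trans
      (natDegree_lagrangePoly_le (hX 0) _ _))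
    (fun β γ => ?_) hsub huni (by positivity) fun y hy => ?_
  · rw [MvPolynomial.eval_aeval_X]
    refine (eval_lagrangePoly (hX 0) (hlt _ γ.2) _).trans ?_
    have hiff : β.1 0 = γ.1 0 ↔ β = γ := by
      rw [Subtype.ext_iff, funext_iff, Fin.forall_fin_one]
    simp only [hiff]
  · simp only [MvPolynomial.eval_aeval_X]
    rw [Finset.sum_coe_sort (multiIndices 1 k)
      fun β => |(lagrangePoly (X 0) (k + 1) (β 0)).eval (y 0)|]
    refine le_trans ?_ ((h 0).sum_abs_eval_lagrangePoly_le ⟨hy.1 0, hy.2 0⟩ (le_refl (k + 1)))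
    rw [← Finset.sum_image (s := multiIndices 1 k) (g := fun β => β 0)
      (f := fun b => |(lagrangePoly (X 0) (k + 1) b).eval (y 0)|)]
    · refine Finset.sum_le_sum_of_subset_of_nonneg ?_ fun _ _ _ => abs_nonneg _
      intro b hb
      obtain ⟨β, hβ, rfl⟩ := Finset.mem_image.1 hb
      exact Finset.mem_range.2 (hlt β hβ)
    · intro β _ γ _ hβγ
      funext j
      rw [Subsingleton.elim j 0]
      exact hβγ

theorem exists_lebesgueConstant_intertwining_le {E : Fin N → ℕ → ℂ} (hN : 1 ≤ N)
    (h : ∀ j, IsRealProjection (E j) (X j)) :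
    ∃ (C : ℝ) (m : ℕ), 0 ≤ C ∧ (m : ℝ) ≤ ((N : ℝ) ^ 2 + 11 * N - 6) / 2 ∧
      ∀ (k : ℕ) (hsub : intertwining X k ⊆ Set.Icc (-1) 1)
        (huni : IsUnisolvent k (intertwining X k)),
        lebesgueConstant hsub huni ≤ C * ((k : ℝ) + 1) ^ m := by
  rcases hN.eq_or_lt with rfl | hN2
  · exact ⟨8, 3, by norm_num, by norm_num, lebesgueConstant_intertwining_one_le h⟩
  · refine ⟨16 ^ N, 4 * N, by positivity, ?_, fun k hsub huni => ?_⟩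
    · have : (2 : ℝ) ≤ N := by exact_mod_cast hN2
      push_cast
      nlinarith
    · rw [pow_mul, ← mul_pow]
      exact lebesgueConstant_intertwining_le h k hsub huni

end Intertwining

/-! ### The asymptotic bounds -/

theorem theorem3p2 (N : ℕ) (hN : 1 ≤ N) (X : Fin N → ℕ → ℝ)
    (hX : ∀ j, IsReLejaSequence (X j)) :
    ∃ (hsub : ∀ k, intertwining X k ⊆ (Set.Icc (-1) 1 : Set (Fin N → ℝ)))
      (huni : ∀ k, IsUnisolvent k (intertwining X k)),
      (∃ m : ℕ, (fun k : ℕ => lebesgueConstant (hsub k) (huni k))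
        =O[atTop] fun k : ℕ => (k : ℝ) ^ m) ∧
      (fun k : ℕ => lebesgueConstant (hsub k) (huni k))
        =O[atTop] fun k : ℕ =>
          (k : ℝ) ^ (((N : ℝ) ^ 2 + 11 * N - 6) / 2) * Real.log k ^ N := by
  choose E hE using fun j => (hX j).exists_isRealProjection
  obtain ⟨C, m, hC, hm, hbound⟩ := exists_lebesgueConstant_intertwining_le hN hE
  have hsub := intertwining_subset_Icc fun j k => (hE j).mem_Icc k
  have huni := isUnisolvent_intertwining fun j => (hE j).injective
  have hO : (fun k : ℕ => lebesgueConstant (hsub k) (huni k))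
      =O[atTop] fun k : ℕ => (k : ℝ) ^ m := by
    -- The factor `2 ^ m` comes from `k + 1 ≤ 2 * k` for `k ≥ 1`.
    refine IsBigO.of_bound (C * 2 ^ m) ?_
    filter_upwards [eventually_ge_atTop 1] with k hk
    have hk1 : (1 : ℝ) ≤ k := by exact_mod_cast hk
    have h0 : 0 ≤ lebesgueConstant (hsub k) (huni k) := by
      exact ContinuousLinearMap.opNorm_nonneg _
    rw [Real.norm_of_nonneg h0, Real.norm_of_nonneg (by positivity), mul_assoc, ← mul_pow]
    refine (hbound k (hsub k) (huni k)).trans (mul_le_mul_of_nonneg_left ?_ hC)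
    exact pow_le_pow_left₀ (by positivity) (by linarith) m
  refine ⟨hsub, huni, ⟨m, hO⟩, hO.trans (IsBigO.of_bound 1 ?_)⟩
  -- From `3 > e` on, `Real.log k ≥ 1`, so the logarithmic factor only enlarges the right side.
  filter_upwards [eventually_ge_atTop 3] with k hk
  have hk3 : (3 : ℝ) ≤ k := by exact_mod_cast hk
  have hlog : 1 ≤ Real.log k := by
    rw [Real.le_log_iff_exp_le (by linarith)]
    exact (Real.exp_one_lt_d9.le.trans (by norm_num)).trans hk3
  have hpow : (k : ℝ) ^ m ≤ (k : ℝ) ^ (((N : ℝ) ^ 2 + 11 * N - 6) / 2) := by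
    rw [← Real.rpow_natCast]
    exact Real.rpow_le_rpow_of_exponent_le (by linarith) hm
  rw [one_mul, Real.norm_of_nonneg (by positivity), Real.norm_of_nonneg (by positivity)]
  exact hpow.trans (le_mul_of_one_le_right (by positivity) (one_le_pow₀ hlog))
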